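/- Let $N\ge 1$ be an integer. Write $\mathbb M_N$ for the algebra of complex $N\times N$ matrices, $\mathrm{tr}(Z)=\frac1N\sum_{n=1}^N Z_{nn}$ for the normalized trace, $\|Z\|_{\mathbb M_N}=\mathrm{tr}(ZZ^*)^{1/2}$, $\mathbb U_N\subset\mathbb M_N$ for the unitary group with identity $I_N$, and $\mathfrak u_N=\{X\in\mathbb M_N: X^*=-X\}$. Let $\beta_N$ be an orthonormal basis of the real vector space $\mathfrak u_N$ for the inner product $\langle X,Y\rangle=N\,\mathrm{Re}\sum_{j,k}X_{jk}\overline{Y_{jk}}$, let $(\partial_X f)(U)=\frac{d}{dr}\big|_{r=0}f(Ue^{rX})$, and let $\Delta_{\mathbb U_N}=\sum_{X\in\beta_N}\partial_X^2$ be the Laplace operator of $\mathbb U_N$ (it does not depend on the choice of $\beta_N$). For $s>0$ let $\rho^N_s$ be the heat kernel measure at time $s$, that is, the unique Borel probability measure on $\mathbb U_N$ with $$\int_{\mathbb U_N} f\,d\rho^N_s=\big(e^{\frac s2\Delta_{\mathbb U_N}}f\big)(I_N)\qquad\text{for all } f\in C(\mathbb U_N),$$ where $u(t,\cdot)=e^{\frac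 t2\Delta_{\mathbb U_N}}f$ is the solution of $\partial_t u=\frac12\Delta_{\mathbb U_N}u$ on $(0,\infty)\times\mathbb U_N$ that is continuous on $[0,\infty)\times\mathbb U_N$ with $u(0,\cdot)=f$. Let $L^2(\mathbb U_N,\rho^N_s;\mathbb M_N)$ be the space of measurable functions $F\colon\mathbb U_N\to\mathbb M_N$ with $$\|F\|^2_{L^2}=\int_{\mathbb U_N}\|F(U)\|^2_{\mathbb M_N}\,\rho^N_s(dU)<\infty$$ (functions that agree $\rho^N_s$-almost everywhere being identified), and let $L^2(\mathbb U_N,\rho^N_s;\mathbb M_N)_{\mathrm{eq}}$ be its subspace of equivariant functions, i.e. those with $F(BAB^{-1})=BF(A)B^{-1}$ for all $A,B\in\mathbb U_N$. A trace polynomial is a function $P_N$ of the form $$P_N(U)=\sum_{k\in\mathbb Z}Q_k\big((\mathrm{tr}(U^j))_{j\in\mathbb Z\setminus\{0\}}\big)\,U^k,$$ where each $Q_k$ is a complex polynomial in the commuting variables $v_j$, $j\in\mathbb Z\setminus\{0\}$, and $Q_k=0$ for all but finitely many $k$. Then for every $s>0$ the space of trace polynomials is a dense subspace of $L^2(\mathbb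 U_N,\rho^N_s;\mathbb M_N)_{\mathrm{eq}}$: every trace polynomial (restricted to $\mathbb U_N$) belongs to $L^2(\mathbb U_N,\rho^N_s;\mathbb M_N)_{\mathrm{eq}}$, and for every $F\in L^2(\mathbb U_N,\rho^N_s;\mathbb M_N)_{\mathrm{eq}}$ and every $\varepsilon>0$ there is a trace polynomial $P_N$ with $\|F-P_N\|_{L^2}<\varepsilon$. -/

import Mathlib

open MeasureTheory Set Filter Topology
open scoped ENNReal

namespace UnitaryHeat

/-- The algebra of complex `N × N` matrices. -/
abbrev Mat (N : ℕ) : Type := Matrix (Fin N) (Fin N) ℂ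

/-- The unitary group, with the topology induced from the matrices. -/
abbrev UN (N : ℕ) : Type := ↥(Matrix.unitaryGroup (Fin N) ℂ)

/-- The Lie algebra of the unitary group: the skew-Hermitian matrices, a real vector space. -/
abbrev LieU (N : ℕ) : Type := ↥(skewAdjoint (Mat N))

/-- The Borel sigma-algebra of the unitary group. -/
noncomputable instance instMeasurableSpaceUN (N : ℕ) : MeasurableSpace (UN N) := borel (UN N)

instance instBorelSpaceUN (N : ℕ) : BorelSpace (UN N) := ⟨rfl⟩

theorem exp_mem_unitaryGroup {N : ℕ} (X : LieU N) :
    NormedSpace.exp (X : Mat N) ∈ Matrix.unitaryGroup (Fin N) ℂ := by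
  have hX : star (X : Mat N) = -(X : Mat N) := X.2
  have hc : Commute (X : Mat N) (-(X : Mat N)) := (Commute.refl (X : Mat N)).neg_right
  rw [Matrix.mem_unitaryGroup_iff, Matrix.star_eq_conjTranspose, ← Matrix.exp_conjTranspose,
    ← Matrix.star_eq_conjTranspose, hX, ← Matrix.exp_add_of_commute _ _ hc, add_neg_cancel,
    NormedSpace.exp_zero]

/-- The matrix exponential of a skew-Hermitian matrix, as a unitary matrix. -/
noncomputable def expU {N : ℕ} (X : LieU N) : UN N :=
  ⟨NormedSpace.exp (X : Mat N), exp_mem_unitaryGroup X⟩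

/-- The matrices of the standard orthonormal basis of the skew-Hermitian matrices for the norm
`‖X‖² = N Tr (X X*)`. -/
noncomputable def basisMatrix (N : ℕ) (j k : Fin N) : Mat N :=
  if j < k then
    ((1 / Real.sqrt (2 * N) : ℝ) : ℂ) • (Matrix.single j k 1 - Matrix.single k j 1)
  else if k < j then
    ((1 / Real.sqrt (2 * N) : ℝ) : ℂ) •
      (Matrix.single j k Complex.I + Matrix.single k j Complex.I)
  else ((1 / Real.sqrt N : ℝ) : ℂ) • Matrix.single j j Complex.I

theorem basisMatrix_mem (N : ℕ) (j k : Fin N) : basisMatrix N j k ∈ skewAdjoint (Mat N) := by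
  have hneg : ∀ (a b : Fin N) (z : ℂ),
      (Matrix.single a b (-z) : Mat N) = -Matrix.single a b z := fun a b z => by
    ext i l
    by_cases h : a = i ∧ b = l <;> simp [h]
  rw [skewAdjoint.mem_iff, Matrix.star_eq_conjTranspose]
  unfold basisMatrix
  split_ifs
  · rw [Matrix.conjTranspose_smul, Matrix.conjTranspose_sub, Matrix.conjTranspose_single,
      Matrix.conjTranspose_single, Complex.star_def, Complex.conj_ofReal, map_one, ← smul_neg,
      neg_sub]
  · rw [Matrix.conjTranspose_smul, Matrix.conjTranspose_add, Matrix.conjTranspose_single,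
      Matrix.conjTranspose_single, Complex.star_def, Complex.conj_ofReal,
      Complex.conj_I, hneg, hneg, ← smul_neg, neg_add, add_comm]
  · rw [Matrix.conjTranspose_smul, Matrix.conjTranspose_single, Complex.star_def,
      Complex.conj_ofReal, Complex.conj_I, hneg, ← smul_neg]

/-- An orthonormal basis of the Lie algebra for the inner product `N Re Tr (X Y*)`, indexed by the
pairs `(j, k)`. -/
noncomputable def lieBasis (N : ℕ) (p : Fin N × Fin N) : LieU N :=
  ⟨basisMatrix N p.1 p.2, basisMatrix_mem N p.1 p.2⟩

/-- The left-invariant derivative `(∂_X f)(U) = d/dr f(U exp(r X))` at `r = 0`. -/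
noncomputable def leftDeriv {N : ℕ} (X : LieU N) (f : UN N → ℝ) (U : UN N) : ℝ :=
  deriv (fun r : ℝ => f (U * expU (r • X))) 0

/-- The Laplace operator of the unitary group, the sum of `∂_X ∂_X` over an orthonormal basis. -/
noncomputable def laplacian {N : ℕ} (f : UN N → ℝ) (U : UN N) : ℝ :=
  ∑ p : Fin N × Fin N, leftDeriv (lieBasis N p) (leftDeriv (lieBasis N p) f) U

/-- `u` is a classical solution of the heat equation `∂u/∂t = (1/2) Δ u` on `(0, ∞) × U(N)`,
continuous up to time zero; thus `u t` is the function `e^{(t/2) Δ} (u 0)`. -/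
structure IsHeatSolution {N : ℕ} (u : ℝ → UN N → ℝ) : Prop where
  continuousOn : ContinuousOn (fun p : ℝ × UN N => u p.1 p.2) (Ici 0 ×ˢ univ)
  contDiff : ∀ t : ℝ, 0 < t → ∀ (U : UN N) (X : LieU N),
    ContDiff ℝ 2 (fun r : ℝ => u t (U * expU (r • X)))
  heat : ∀ t : ℝ, 0 < t → ∀ U : UN N,
    HasDerivAt (fun τ : ℝ => u τ U) ((1 / 2) * laplacian (u t) U) t

/-- `ρ` is the heat kernel measure at time `s`: the Borel probability measure with
`∫ f dρ = (e^{(s/2) Δ} f)(I)`. -/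
structure IsHeatKernelMeasure (N : ℕ) (s : ℝ) (ρ : Measure (UN N)) : Prop where
  isProbabilityMeasure : IsProbabilityMeasure ρ
  integral_eq : ∀ u : ℝ → UN N → ℝ, IsHeatSolution u → ∫ U, u 0 U ∂ρ = u s 1

/-! ### Existence and uniqueness of the heat kernel measure -/

theorem instCompactSpaceUN (N : ℕ) : CompactSpace (UN N) := by
  have hc : IsCompact (Set.pi univ fun _ : Fin N => Set.pi univ fun _ : Fin N =>
      Metric.closedBall (0 : ℂ) 1) :=
    isCompact_univ_pi fun _ => isCompact_univ_pi fun _ => isCompact_closedBall _ _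
  have hcl : IsClosed ((Matrix.unitaryGroup (Fin N) ℂ : Submonoid (Mat N)) : Set (Mat N)) :=
    isClosed_unitary
  refine isCompact_iff_compactSpace.mp (IsCompact.of_isClosed_subset hc hcl ?_)
  intro U hU i _ j _
  simpa using entry_norm_bound_of_unitary hU i j

attribute [instance] instCompactSpaceUN

theorem expU_add_smul {N : ℕ} (X : LieU N) (r q : ℝ) :
    expU ((r + q) • X) = expU (r • X) * expU (q • X) := by
  apply Subtype.ext
  have hc : Commute (r • (X : Mat N)) (q • (X : Mat N)) :=
    ((Commute.refl (X : Mat N)).smul_left r).smul_right q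
  have h := Matrix.exp_add_of_commute _ _ hc
  rw [← add_smul] at h
  exact h

theorem expU_zero_smul {N : ℕ} (X : LieU N) : expU ((0 : ℝ) • X) = 1 := by
  apply Subtype.ext
  simp [expU]

theorem leftDeriv_curve {N : ℕ} (X : LieU N) (f : UN N → ℝ) (U : UN N) (r : ℝ) :
    leftDeriv X f (U * expU (r • X)) = deriv (fun r : ℝ => f (U * expU (r • X))) r := by
  unfold leftDeriv
  have : (fun q : ℝ => f (U * expU (r • X) * expU (q • X))) =
      fun q : ℝ => (fun r : ℝ => f (U * expU (r • X))) (r + q) := by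
    funext q
    simp only [expU_add_smul, mul_assoc]
  rw [this, deriv_comp_const_add (fun r : ℝ => f (U * expU (r • X))) r 0, add_zero]

theorem leftDeriv_leftDeriv {N : ℕ} (X : LieU N) (f : UN N → ℝ) (U : UN N) :
    leftDeriv X (leftDeriv X f) U = deriv (deriv fun r : ℝ => f (U * expU (r • X))) 0 := by
  conv_lhs => unfold leftDeriv
  congr 1
  funext r
  exact leftDeriv_curve X f U r

theorem deriv_deriv_nonneg_of_isMin {φ : ℝ → ℝ} (hφ : ContDiff ℝ 2 φ)
    (hmin : ∀ r, φ 0 ≤ φ r) : 0 ≤ deriv (deriv φ) 0 := by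
  by_contra! hneg
  have hm : IsLocalMin φ 0 := Eventually.of_forall hmin
  have hM := isLocalMax_of_deriv_deriv_neg hneg hm.deriv_eq_zero hφ.continuous.continuousAt
  have hc : φ =ᶠ[𝓝 0] fun _ => φ 0 := by
    filter_upwards [hM] with r hr using le_antisymm hr (hmin r)
  have h2 := hc.deriv.deriv_eq
  simp at h2
  linarith

/-- The minimum principle for the heat equation. -/
theorem IsHeatSolution.le {N : ℕ} {u : ℝ → UN N → ℝ} (hu : IsHeatSolution u) {c : ℝ}
    (hc : ∀ U, c ≤ u 0 U) {T : ℝ} (hT : 0 ≤ T) (U : UN N) : c ≤ u T U := by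
  have key : ∀ ε : ℝ, 0 < ε → c ≤ u T U + ε * T := by
    intro ε hε
    have hK : IsCompact (Icc (0 : ℝ) T ×ˢ (univ : Set (UN N))) := isCompact_Icc.prod isCompact_univ
    have hcont : ContinuousOn (fun p : ℝ × UN N => u p.1 p.2 + ε * p.1)
        (Icc (0 : ℝ) T ×ˢ (univ : Set (UN N))) :=
      (hu.continuousOn.mono (prod_mono Icc_subset_Ici_self subset_rfl)).add
        (continuous_const.mul continuous_fst).continuousOn
    obtain ⟨⟨t, x⟩, ⟨ht, -⟩, hmin⟩ := hK.exists_isMinOn ⟨(T, U), ⟨⟨hT, le_rfl⟩, trivial⟩⟩ hcont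
    have hmin' : ∀ τ ∈ Icc (0 : ℝ) T, ∀ y, u t x + ε * t ≤ u τ y + ε * τ := fun τ hτ y =>
      hmin (show (τ, y) ∈ Icc (0 : ℝ) T ×ˢ (univ : Set (UN N)) from ⟨hτ, trivial⟩)
    refine le_trans ?_ (hmin' T ⟨hT, le_rfl⟩ U)
    have ht0 : 0 ≤ t := ht.1
    rcases ht0.eq_or_lt with h0 | h0
    · have h1 := hc x
      rw [h0] at h1
      have h2 : ε * t = 0 := by rw [← h0, mul_zero]
      rw [h2, add_zero]
      exact h1
    · exfalso
      have hlap : 0 ≤ laplacian (u t) x := by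
        refine Finset.sum_nonneg fun p _ => ?_
        rw [leftDeriv_leftDeriv]
        refine deriv_deriv_nonneg_of_isMin (hu.contDiff t h0 x _) fun r => ?_
        rw [expU_zero_smul, mul_one]
        have := hmin' t ht (x * expU (r • lieBasis N p))
        linarith
      have hd : HasDerivAt (fun τ : ℝ => u τ x + ε * τ)
          ((1 / 2) * laplacian (u t) x + ε * 1) t :=
        (hu.heat t h0 x).add ((hasDerivAt_id t).const_mul ε)
      have hslope : Tendsto (slope (fun τ : ℝ => u τ x + ε * τ) t) (𝓝[<] t)
          (𝓝 ((1 / 2) * laplacian (u t) x + ε * 1)) :=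
        (hasDerivAt_iff_tendsto_slope.mp hd).mono_left
          (nhdsWithin_mono _ fun y hy => ne_of_lt hy)
      have hle : (1 / 2) * laplacian (u t) x + ε * 1 ≤ 0 := by
        refine le_of_tendsto hslope ?_
        filter_upwards [Ioo_mem_nhdsLT h0] with τ hτ
        rw [slope_def_field]
        have h3 := hmin' τ ⟨hτ.1.le, hτ.2.le.trans ht.2⟩ x
        exact div_nonpos_of_nonneg_of_nonpos (by linarith) (by linarith [hτ.2])
      linarith
  refine le_of_forall_pos_le_add fun δ hδ => ?_
  have h := key (δ / (T + 1)) (by positivity)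
  have h2 : δ / (T + 1) * T ≤ δ := by
    rw [div_mul_eq_mul_div, div_le_iff₀ (by positivity)]
    nlinarith
  linarith

theorem IsHeatSolution.combo {N : ℕ} {u v : ℝ → UN N → ℝ} (hu : IsHeatSolution u)
    (hv : IsHeatSolution v) (a b : ℝ) :
    IsHeatSolution fun t U => a * u t U + b * v t U where
  continuousOn := (continuousOn_const.mul hu.continuousOn).add
    (continuousOn_const.mul hv.continuousOn)
  contDiff t ht U X := (contDiff_const.mul (hu.contDiff t ht U X)).add
    (contDiff_const.mul (hv.contDiff t ht U X))
  heat t ht U := by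
    have hlap : laplacian (fun U => a * u t U + b * v t U) U =
        a * laplacian (u t) U + b * laplacian (v t) U := by
      unfold laplacian
      rw [Finset.mul_sum, Finset.mul_sum, ← Finset.sum_add_distrib]
      refine Finset.sum_congr rfl fun p _ => ?_
      simp only [leftDeriv_leftDeriv]
      have h1 := hu.contDiff t ht U (lieBasis N p)
      have h2 := hv.contDiff t ht U (lieBasis N p)
      have d1 : Differentiable ℝ (deriv fun r : ℝ => u t (U * expU (r • lieBasis N p))) :=
        (h1.differentiable_deriv_two)
      have d2 : Differentiable ℝ (deriv fun r : ℝ => v t (U * expU (r • lieBasis N p))) :=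
        (h2.differentiable_deriv_two)
      have e1 : (deriv fun r : ℝ => a * u t (U * expU (r • lieBasis N p)) +
          b * v t (U * expU (r • lieBasis N p))) = fun r =>
          a * deriv (fun r : ℝ => u t (U * expU (r • lieBasis N p))) r +
          b * deriv (fun r : ℝ => v t (U * expU (r • lieBasis N p))) r := by
        funext r
        exact (((h1.differentiable (by norm_num) r).hasDerivAt.const_mul a).add
          ((h2.differentiable (by norm_num) r).hasDerivAt.const_mul b)).deriv
      rw [e1]
      exact (((d1 0).hasDerivAt.const_mul a).add ((d2 0).hasDerivAt.const_mul b)).deriv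
    rw [hlap]
    exact (((hu.heat t ht U).const_mul a).add ((hv.heat t ht U).const_mul b)).congr_deriv (by ring)

theorem IsHeatSolution.const {N : ℕ} (c : ℝ) : IsHeatSolution fun _ (_ : UN N) => c where
  continuousOn := continuousOn_const
  contDiff _ _ _ _ := contDiff_const
  heat t _ U := by
    have : laplacian (fun _ : UN N => c) U = 0 := by simp [laplacian, leftDeriv]
    rw [this, mul_zero]
    exact hasDerivAt_const t c

theorem IsHeatSolution.abs_sub_le {N : ℕ} {u v : ℝ → UN N → ℝ} (hu : IsHeatSolution u)
    (hv : IsHeatSolution v) {c : ℝ} (hc : ∀ U, |u 0 U - v 0 U| ≤ c) {T : ℝ} (hT : 0 ≤ T)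
    (U : UN N) : |u T U - v T U| ≤ c := by
  have h1 := (hu.combo hv 1 (-1)).le (c := -c)
    (fun U => by linarith [neg_le_of_abs_le (hc U)]) hT U
  have h2 := (hu.combo hv (-1) 1).le (c := -c)
    (fun U => by linarith [le_of_abs_le (hc U)]) hT U
  exact abs_le.mpr ⟨by linarith, by linarith⟩

/-- Continuous functions in the span of a finite family of continuous functions which is mapped
to its own span by every left-invariant derivative. -/
def IsRepresentative {N : ℕ} (f : UN N → ℝ) : Prop :=
  ∃ (ι : Type) (_ : Fintype ι) (_ : DecidableEq ι) (w : ι → UN N → ℝ)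
    (D : LieU N → Matrix ι ι ℝ) (c : ι → ℝ),
    (∀ i, Continuous (w i)) ∧
    (∀ X i U, HasDerivAt (fun r : ℝ => w i (U * expU (r • X))) (∑ j, D X i j * w j U) 0) ∧
    ∀ U, f U = ∑ i, c i * w i U

theorem IsRepresentative.continuous {N : ℕ} {f : UN N → ℝ} (hf : IsRepresentative f) :
    Continuous f := by
  obtain ⟨ι, _, _, w, D, c, hw, -, h⟩ := hf
  rw [show f = fun U => ∑ i, c i * w i U from funext h]
  exact continuous_finsetSum _ fun i _ => continuous_const.mul (hw i)

theorem IsRepresentative.const {N : ℕ} (a : ℝ) : IsRepresentative fun _ : UN N => a :=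
  ⟨Unit, inferInstance, inferInstance, fun _ _ => 1, fun _ => 0, fun _ => a,
    fun _ => continuous_const, fun X i U => by simpa using hasDerivAt_const (0 : ℝ) (1 : ℝ),
    fun U => by simp⟩

theorem IsRepresentative.add {N : ℕ} {f g : UN N → ℝ} (hf : IsRepresentative f)
    (hg : IsRepresentative g) : IsRepresentative fun U => f U + g U := by
  obtain ⟨ι, _, _, w, D, c, hw, hD, h⟩ := hf
  obtain ⟨κ, _, _, w', D', c', hw', hD', h'⟩ := hg
  refine ⟨ι ⊕ κ, inferInstance, inferInstance, Sum.elim w w',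
    fun X => Matrix.fromBlocks (D X) 0 0 (D' X), Sum.elim c c', ?_, ?_, ?_⟩
  · rintro (i | i)
    · exact hw i
    · exact hw' i
  · rintro X (i | i) U
    · simpa using hD X i U
    · simpa using hD' X i U
  · intro U
    simp [h, h']

theorem IsRepresentative.mul {N : ℕ} {f g : UN N → ℝ} (hf : IsRepresentative f)
    (hg : IsRepresentative g) : IsRepresentative fun U => f U * g U := by
  obtain ⟨ι, _, _, w, D, c, hw, hD, h⟩ := hf
  obtain ⟨κ, _, _, w', D', c', hw', hD', h'⟩ := hg
  refine ⟨ι × κ, inferInstance, inferInstance, fun p U => w p.1 U * w' p.2 U,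
    fun X p q => (if p.2 = q.2 then D X p.1 q.1 else 0) + (if p.1 = q.1 then D' X p.2 q.2 else 0),
    fun p => c p.1 * c' p.2, fun p => (hw p.1).mul (hw' p.2), ?_, ?_⟩
  · rintro X ⟨i, j⟩ U
    refine ((hD X i U).mul (hD' X j U)).congr_deriv ?_
    simp only [expU_zero_smul, mul_one, add_mul, Finset.sum_add_distrib, Fintype.sum_prod_type,
      ite_mul, zero_mul, Finset.sum_ite_eq, Finset.mem_univ, if_true, Finset.sum_mul,
      Finset.mul_sum]
    congr 1
    · exact Finset.sum_congr rfl fun k _ => by ring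
    · rw [Finset.sum_comm]
      simp only [Finset.sum_ite_eq, Finset.mem_univ, if_true]
      exact Finset.sum_congr rfl fun k _ => by ring
  · intro U
    change f U * g U = ∑ p : ι × κ, c p.1 * c' p.2 * (w p.1 U * w' p.2 U)
    rw [h, h', Finset.sum_mul_sum, Fintype.sum_prod_type]
    exact Finset.sum_congr rfl fun i _ => Finset.sum_congr rfl fun j _ => by ring

section Entries

attribute [local instance] Matrix.linftyOpNormedRing Matrix.linftyOpNormedAlgebra

theorem hasDerivAt_entry {N : ℕ} (X : LieU N) (U : UN N) (a b : Fin N) :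
    HasDerivAt (fun r : ℝ => (U * expU (r • X) : UN N).1 a b)
      (∑ k, (U : Mat N) a k * (X : Mat N) k b) 0 := by
  have h1 : HasDerivAt (fun r : ℝ => NormedSpace.exp (r • (X : Mat N))) (X : Mat N) 0 := by
    have := hasDerivAt_exp_smul_const (𝕂 := ℝ) (X : Mat N) 0
    rw [zero_smul, NormedSpace.exp_zero, one_mul] at this
    exact this
  have h2 : HasDerivAt (fun r : ℝ => (U : Mat N) * NormedSpace.exp (r • (X : Mat N)))
      ((U : Mat N) * (X : Mat N)) 0 := h1.const_mul (U : Mat N)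
  have h3 : ∀ k, HasDerivAt (fun r : ℝ => NormedSpace.exp (r • (X : Mat N)) k b)
      ((X : Mat N) k b) 0 := fun k => by
    have := (LinearMap.toContinuousLinearMap
      (Matrix.entryLinearMap ℝ ℂ k b : Mat N →ₗ[ℝ] ℂ)).hasFDerivAt.comp_hasDerivAt 0 h1
    exact this
  have h4 := HasDerivAt.fun_sum (u := Finset.univ) fun k _ => (h3 k).const_mul ((U : Mat N) a k)
  exact h4

theorem hasDerivAt_exp_mulVec {ι : Type} [Fintype ι] [DecidableEq ι] (C : Matrix ι ι ℝ)
    (c v : ι → ℝ) (t : ℝ) :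
    HasDerivAt (fun τ : ℝ => ∑ i, Matrix.vecMul c (NormedSpace.exp ((τ / 2) • C)) i * v i)
      (∑ i, (1 / 2) * (Matrix.vecMul (Matrix.vecMul c (NormedSpace.exp ((t / 2) • C))) C i * v i))
      t := by
  have h1 : HasDerivAt (fun τ : ℝ => NormedSpace.exp ((τ / 2) • C))
      ((1 / 2 : ℝ) • (NormedSpace.exp ((t / 2) • C) * C)) t := by
    have h0 : HasDerivAt (fun τ : ℝ => τ / 2) (1 / 2) t := (hasDerivAt_id' t).div_const 2
    exact HasDerivAt.scomp (h := fun τ : ℝ => τ / 2) t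
      (hasDerivAt_exp_smul_const (𝕂 := ℝ) C (t / 2)) h0
  have h2 : ∀ i j, HasDerivAt (fun τ : ℝ => NormedSpace.exp ((τ / 2) • C) i j)
      (((1 / 2 : ℝ) • (NormedSpace.exp ((t / 2) • C) * C)) i j) t := fun i j =>
    (LinearMap.toContinuousLinearMap
      (Matrix.entryLinearMap ℝ ℝ i j : Matrix ι ι ℝ →ₗ[ℝ] ℝ)).hasFDerivAt.comp_hasDerivAt t h1
  have h3 : ∀ i, HasDerivAt (fun τ : ℝ => Matrix.vecMul c (NormedSpace.exp ((τ / 2) • C)) i)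
      ((1 / 2) * Matrix.vecMul (Matrix.vecMul c (NormedSpace.exp ((t / 2) • C))) C i) t :=
    fun i => by
      have := HasDerivAt.fun_sum (u := Finset.univ) fun k _ => (h2 k i).const_mul (c k)
      refine HasDerivAt.congr_deriv this ?_
      rw [Matrix.vecMul_vecMul]
      simp only [Matrix.vecMul, dotProduct, Finset.mul_sum, Matrix.smul_apply, smul_eq_mul]
      exact Finset.sum_congr rfl fun k _ => by ring
  refine (HasDerivAt.fun_sum (u := Finset.univ) fun i _ => (h3 i).mul_const (v i)).congr_deriv ?_
  exact Finset.sum_congr rfl fun k _ => by ring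

theorem continuous_exp_vecMul {ι : Type} [Fintype ι] [DecidableEq ι] (C : Matrix ι ι ℝ)
    (c : ι → ℝ) (i : ι) :
    Continuous fun τ : ℝ => Matrix.vecMul c (NormedSpace.exp ((τ / 2) • C)) i := by
  have h1 : Continuous fun τ : ℝ => NormedSpace.exp ((τ / 2) • C) :=
    NormedSpace.exp_continuous.comp (by fun_prop)
  have h2 : ∀ k, Continuous fun τ : ℝ => NormedSpace.exp ((τ / 2) • C) k i := fun k =>
    (LinearMap.toContinuousLinearMap
      (Matrix.entryLinearMap ℝ ℝ k i : Matrix ι ι ℝ →ₗ[ℝ] ℝ)).continuous.comp h1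
  exact continuous_finsetSum _ fun k _ => continuous_const.mul (h2 k)

end Entries

theorem continuous_entry {N : ℕ} (a b : Fin N) : Continuous fun U : UN N => (U : Mat N) a b :=
  (continuous_subtype_val (p := fun M : Mat N => M ∈ Matrix.unitaryGroup (Fin N) ℂ)).matrix_elem a b

theorem isRepresentative_re_im {N : ℕ} (a b : Fin N) :
    IsRepresentative (fun U : UN N => ((U : Mat N) a b).re) ∧
    IsRepresentative (fun U : UN N => ((U : Mat N) a b).im) := by
  have main : ∀ c : Fin N ⊕ Fin N → ℝ, IsRepresentative fun U : UN N =>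
      ∑ i, c i * Sum.elim (fun k => ((U : Mat N) a k).re) (fun k => ((U : Mat N) a k).im) i := by
    intro c
    refine ⟨Fin N ⊕ Fin N, inferInstance, inferInstance,
      Sum.elim (fun k U => ((U : Mat N) a k).re) (fun k U => ((U : Mat N) a k).im),
      fun X => Matrix.fromBlocks (Matrix.of fun l k => ((X : Mat N) k l).re)
        (Matrix.of fun l k => -((X : Mat N) k l).im) (Matrix.of fun l k => ((X : Mat N) k l).im)
        (Matrix.of fun l k => ((X : Mat N) k l).re), c, ?_, ?_, ?_⟩
    · rintro (k | k)
      · exact Complex.continuous_re.comp (continuous_entry a k)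
      · exact Complex.continuous_im.comp (continuous_entry a k)
    · rintro X (k | k) U
      · have := Complex.reCLM.hasFDerivAt.comp_hasDerivAt 0 (hasDerivAt_entry X U a k)
        refine HasDerivAt.congr_deriv this ?_
        simp only [map_sum, Complex.reCLM_apply, Complex.mul_re, Fintype.sum_sum_type,
          Matrix.fromBlocks_apply₁₁, Matrix.fromBlocks_apply₁₂, Matrix.of_apply, Sum.elim_inl,
          Sum.elim_inr]
        rw [← Finset.sum_add_distrib]
        exact Finset.sum_congr rfl fun j _ => by ring
      · have := Complex.imCLM.hasFDerivAt.comp_hasDerivAt 0 (hasDerivAt_entry X U a k)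
        refine HasDerivAt.congr_deriv this ?_
        simp only [map_sum, Complex.imCLM_apply, Complex.mul_im, Fintype.sum_sum_type,
          Matrix.fromBlocks_apply₂₁, Matrix.fromBlocks_apply₂₂, Matrix.of_apply, Sum.elim_inl,
          Sum.elim_inr]
        rw [← Finset.sum_add_distrib]
        exact Finset.sum_congr rfl fun j _ => by ring
    · intro U
      refine Finset.sum_congr rfl fun i _ => ?_
      rcases i with i | i <;> rfl
  constructor
  · simpa [Pi.single_apply] using main (Pi.single (Sum.inl b) 1)
  · simpa [Pi.single_apply] using main (Pi.single (Sum.inr b) 1)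

/-- The heat equation can be solved with every representative function as initial value. -/
theorem IsRepresentative.exists_isHeatSolution {N : ℕ} {f : UN N → ℝ} (hf : IsRepresentative f) :
    ∃ u : ℝ → UN N → ℝ, IsHeatSolution u ∧ u 0 = f := by
  obtain ⟨ι, _, _, w, D, c, hw, hD, h⟩ := hf
  set C : Matrix ι ι ℝ := ∑ p : Fin N × Fin N, D (lieBasis N p) * D (lieBasis N p) with hC
  have hcurve : ∀ (d : ι → ℝ) (X : LieU N) (U : UN N) (r : ℝ),
      HasDerivAt (fun r : ℝ => ∑ i, d i * w i (U * expU (r • X)))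
        (∑ i, Matrix.vecMul d (D X) i * w i (U * expU (r • X))) r := by
    intro d X U r
    have h1 : ∀ i, HasDerivAt (fun r : ℝ => w i (U * expU (r • X)))
        (∑ j, D X i j * w j (U * expU (r • X))) r := by
      intro i
      have h2 := hD X i (U * expU (r • X))
      have h3 : HasDerivAt (fun q : ℝ => q - r) 1 r := (hasDerivAt_id r).sub_const r
      rw [← sub_self r] at h2
      have h4 := HasDerivAt.comp (h₂ := fun q : ℝ => w i (U * expU (r • X) * expU (q • X)))
        (h := fun q : ℝ => q - r) r h2 h3
      rw [mul_one] at h4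
      refine h4.congr_of_eventuallyEq (Eventually.of_forall fun q => ?_)
      simp only [Function.comp_apply, mul_assoc, ← expU_add_smul]
      rw [add_sub_cancel]
    refine (HasDerivAt.fun_sum (u := Finset.univ) fun i _ => (h1 i).const_mul (d i)).congr_deriv ?_
    simp only [Matrix.vecMul, dotProduct, Finset.mul_sum, Finset.sum_mul]
    rw [Finset.sum_comm]
    exact Finset.sum_congr rfl fun i _ => Finset.sum_congr rfl fun j _ => by ring
  have hsmooth : ∀ (n : ℕ) (d : ι → ℝ) (X : LieU N) (U : UN N),
      ContDiff ℝ n (fun r : ℝ => ∑ i, d i * w i (U * expU (r • X))) := by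
    intro n
    induction n with
    | zero =>
      intro d X U
      exact contDiff_zero.mpr (continuous_iff_continuousAt.mpr fun r =>
        (hcurve d X U r).continuousAt)
    | succ n ih =>
      intro d X U
      have he : deriv (fun r : ℝ => ∑ i, d i * w i (U * expU (r • X))) =
          fun r : ℝ => ∑ i, Matrix.vecMul d (D X) i * w i (U * expU (r • X)) :=
        funext fun r => (hcurve d X U r).deriv
      rw [Nat.cast_add, Nat.cast_one, contDiff_succ_iff_deriv]
      refine ⟨fun r => (hcurve d X U r).differentiableAt, by simp, ?_⟩
      rw [he]
      exact ih _ X U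
  have hleft : ∀ (d : ι → ℝ) (X : LieU N), leftDeriv X (fun U => ∑ i, d i * w i U) =
      fun U => ∑ i, Matrix.vecMul d (D X) i * w i U := by
    intro d X
    funext U
    have := (hcurve d X U 0).deriv
    rw [expU_zero_smul, mul_one] at this
    exact this
  have hlap : ∀ (d : ι → ℝ) (U : UN N), laplacian (fun U => ∑ i, d i * w i U) U =
      ∑ i, Matrix.vecMul d C i * w i U := by
    intro d U
    unfold laplacian
    simp only [hleft, Matrix.vecMul_vecMul]
    rw [Finset.sum_comm]
    refine Finset.sum_congr rfl fun i _ => ?_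
    rw [← Finset.sum_mul, hC]
    congr 1
    simp only [Matrix.vecMul, dotProduct, Matrix.sum_apply, Finset.mul_sum]
    rw [Finset.sum_comm]
  refine ⟨fun t U => ∑ i, Matrix.vecMul c (NormedSpace.exp ((t / 2) • C)) i * w i U,
    ⟨?_, ?_, ?_⟩, ?_⟩
  · refine Continuous.continuousOn (continuous_finsetSum _ fun i _ => ?_)
    exact ((continuous_exp_vecMul C c i).comp continuous_fst).mul ((hw i).comp continuous_snd)
  · intro t _ U X
    exact hsmooth 2 _ X U
  · intro t _ U
    rw [hlap, Finset.mul_sum]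
    exact hasDerivAt_exp_mulVec C c (fun i => w i U) t
  · funext U
    simp [h]

/-- The algebra of representative functions. -/
noncomputable def repAlgebra (N : ℕ) : Subalgebra ℝ C(UN N, ℝ) where
  carrier := {f | IsRepresentative f}
  mul_mem' hf hg := hf.mul hg
  add_mem' hf hg := hf.add hg
  algebraMap_mem' a := IsRepresentative.const a

/-- Representative functions are uniformly dense in the continuous functions. -/
theorem exists_isRepresentative_near {N : ℕ} (f : C(UN N, ℝ)) {ε : ℝ} (hε : 0 < ε) :
    ∃ g ∈ repAlgebra N, ‖f - g‖ < ε := by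
  have hsep : (repAlgebra N).SeparatesPoints := by
    intro U V hUV
    by_contra! hcon
    apply hUV
    apply Subtype.ext
    ext a b
    obtain ⟨h1, h2⟩ := isRepresentative_re_im (N := N) a b
    apply Complex.ext
    · exact hcon _ ⟨⟨_, h1.continuous⟩, h1, rfl⟩
    · exact hcon _ ⟨⟨_, h2.continuous⟩, h2, rfl⟩
  have htop :=
    ContinuousMap.subalgebra_topologicalClosure_eq_top_of_separatesPoints (repAlgebra N) hsep
  have hmem : f ∈ (repAlgebra N).topologicalClosure := by rw [htop]; trivial
  rw [← SetLike.mem_coe, Subalgebra.topologicalClosure_coe, Metric.mem_closure_iff] at hmem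
  obtain ⟨g, hg, hd⟩ := hmem ε hε
  exact ⟨g, hg, by rwa [dist_eq_norm] at hd⟩

theorem exists_heat_functional (N : ℕ) {s : ℝ} (hs : 0 ≤ s) :
    ∃ L : C(UN N, ℝ) →ₗ[ℝ] ℝ, (∀ f, 0 ≤ f → 0 ≤ L f) ∧
      ∀ u : ℝ → UN N → ℝ, IsHeatSolution u → ∀ f : C(UN N, ℝ), (∀ U, f U = u 0 U) →
        L f = u s 1 := by
  choose v hv hv0 using fun f : repAlgebra N => IsRepresentative.exists_isHeatSolution f.2
  have hv0' : ∀ (f : repAlgebra N) U, v f 0 U = f.1 U := fun f U => congrFun (hv0 f) U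
  have huniq : ∀ u : ℝ → UN N → ℝ, IsHeatSolution u → ∀ f : repAlgebra N, ∀ c : ℝ,
      (∀ U, |f.1 U - u 0 U| ≤ c) → |v f s 1 - u s 1| ≤ c := fun u hu f c h =>
    (hv f).abs_sub_le hu (fun U => by rw [hv0']; exact h U) hs 1
  let E : Subalgebra.toSubmodule (repAlgebra N) →ₗ[ℝ] ℝ :=
    { toFun := fun f => v f s 1
      map_add' := fun f g => by
        have := huniq _ ((hv f).combo (hv g) 1 1) (f + g) 0 fun U => by
          rw [hv0']
          have : (f + g).1 U = f.1 U + g.1 U := rfl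
          rw [hv0', this, one_mul, one_mul, sub_self, abs_zero]
        rw [abs_nonpos_iff, sub_eq_zero] at this
        rw [this, one_mul, one_mul]
      map_smul' := fun a f => by
        have := huniq _ ((hv f).combo (hv f) a 0) (a • f) 0 fun U => by
          rw [hv0']
          have : (a • f).1 U = a * f.1 U := rfl
          rw [this, zero_mul, add_zero, sub_self, abs_zero]
        rw [abs_nonpos_iff, sub_eq_zero] at this
        rw [this, zero_mul, add_zero, smul_eq_mul, RingHom.id_apply] }
  have hE : ∀ f, ‖E f‖ ≤ 1 * ‖f‖ := by
    intro f
    have := huniq _ (IsHeatSolution.const 0) f ‖f‖ fun U => by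
      rw [sub_zero]
      exact f.1.norm_coe_le_norm U
    rw [sub_zero] at this
    rw [one_mul]
    exact this
  obtain ⟨g, hg, -⟩ := exists_extension_norm_eq _ (E.mkContinuous 1 hE)
  have hgE : ∀ f : repAlgebra N, g f.1 = v f s 1 := fun f => hg f
  have hgu : ∀ u : ℝ → UN N → ℝ, IsHeatSolution u → ∀ f : C(UN N, ℝ), (∀ U, f U = u 0 U) →
        g f = u s 1 := by
    intro u hu f hf
    have hle : ∀ ε : ℝ, 0 < ε → |g f - u s 1| ≤ (‖g‖ + 1) * ε := by
      intro ε hε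
      obtain ⟨a, ha, hfa⟩ := exists_isRepresentative_near f hε
      have h1 : |g f - g a| ≤ ‖g‖ * ε := by
        rw [← map_sub, ← Real.norm_eq_abs]
        exact (g.le_opNorm _).trans (by gcongr)
      have h2 : |g a - u s 1| ≤ ε := by
        rw [hgE ⟨a, ha⟩]
        refine huniq u hu ⟨a, ha⟩ ε fun U => ?_
        rw [← hf, abs_sub_comm]
        exact ((f - a).norm_coe_le_norm U).trans hfa.le
      calc |g f - u s 1| ≤ |g f - g a| + |g a - u s 1| := abs_sub_le _ _ _
        _ ≤ (‖g‖ + 1) * ε := by linarith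
    have hpos : 0 < ‖g‖ + 1 := by positivity
    have : |g f - u s 1| ≤ 0 := le_of_forall_pos_le_add fun δ hδ => by
      have := hle (δ / (‖g‖ + 1)) (by positivity)
      rwa [mul_div_cancel₀ _ hpos.ne', ← zero_add δ] at this
    rwa [abs_nonpos_iff, sub_eq_zero] at this
  refine ⟨g.toLinearMap, fun f hf => ?_, hgu⟩
  have hpos : 0 < ‖g‖ + 1 := by positivity
  refine le_of_forall_pos_le_add fun δ hδ => ?_
  obtain ⟨a, ha, hfa⟩ := exists_isRepresentative_near f (ε := δ / (‖g‖ + 1)) (by positivity)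
  have h1 : |g f - g a| ≤ ‖g‖ * (δ / (‖g‖ + 1)) := by
    rw [← map_sub, ← Real.norm_eq_abs]
    exact (g.le_opNorm _).trans (by gcongr)
  have h2 : -(δ / (‖g‖ + 1)) ≤ g a := by
    rw [hgE ⟨a, ha⟩]
    refine (hv ⟨a, ha⟩).le (fun U => ?_) hs 1
    rw [hv0']
    have h3 : |f U - a U| ≤ δ / (‖g‖ + 1) := ((f - a).norm_coe_le_norm U).trans hfa.le
    have h4 : 0 ≤ f U := hf U
    linarith [le_of_abs_le h3]
  have h5 : (‖g‖ + 1) * (δ / (‖g‖ + 1)) = δ := mul_div_cancel₀ _ hpos.ne'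
  have h6 := neg_le_of_abs_le h1
  show 0 ≤ g f + δ
  linarith

theorem exists_isHeatKernelMeasure (N : ℕ) {s : ℝ} (hs : 0 ≤ s) :
    ∃ ρ : Measure (UN N), IsHeatKernelMeasure N s ρ := by
  obtain ⟨L, hL, hLu⟩ := exists_heat_functional N hs
  let L' : CompactlySupportedContinuousMap (UN N) ℝ →ₗ[ℝ] ℝ :=
    { toFun := fun f => L f.toContinuousMap
      map_add' := fun f g => L.map_add _ _
      map_smul' := fun a f => L.map_smul a _ }
  let Λ : CompactlySupportedContinuousMap (UN N) ℝ →ₚ[ℝ] ℝ :=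
    PositiveLinearMap.mk₀ L' fun f hf => hL _ fun U => hf U
  have hint : ∀ u : ℝ → UN N → ℝ, IsHeatSolution u →
      ∫ U, u 0 U ∂(RealRMK.rieszMeasure Λ) = u s 1 := by
    intro u hu
    have hc : Continuous (u 0) := by
      have : Continuous fun U : UN N => ((0 : ℝ), U) := by fun_prop
      exact hu.continuousOn.comp_continuous this fun U => ⟨mem_Ici.mpr le_rfl, trivial⟩
    let f : CompactlySupportedContinuousMap (UN N) ℝ :=
      ⟨⟨u 0, hc⟩, HasCompactSupport.of_compactSpace _⟩
    have h1 := RealRMK.integral_rieszMeasure Λ f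
    rw [show (∫ U, u 0 U ∂(RealRMK.rieszMeasure Λ)) = ∫ U, f U ∂(RealRMK.rieszMeasure Λ) from rfl,
      h1]
    exact hLu u hu _ fun U => rfl
  refine ⟨RealRMK.rieszMeasure Λ, ⟨?_⟩, hint⟩
  have h1 := hint _ (IsHeatSolution.const 1)
  rw [integral_const, smul_eq_mul, mul_one, measureReal_def] at h1
  exact (ENNReal.toReal_eq_one_iff _).mp h1

theorem IsHeatKernelMeasure.unique {N : ℕ} {s : ℝ} {ρ ρ' : Measure (UN N)}
    (h : IsHeatKernelMeasure N s ρ) (h' : IsHeatKernelMeasure N s ρ') : ρ = ρ' := by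
  have := h.isProbabilityMeasure
  have := h'.isProbabilityMeasure
  have hmet : TopologicalSpace.MetrizableSpace (Mat N) :=
    inferInstanceAs (TopologicalSpace.MetrizableSpace (Fin N → Fin N → ℂ))
  have hmet' : TopologicalSpace.MetrizableSpace (UN N) :=
    Topology.IsEmbedding.subtypeVal.metrizableSpace
  let _ : MetricSpace (UN N) := TopologicalSpace.metrizableSpaceMetric (UN N)
  refine ext_of_forall_integral_eq_of_IsFiniteMeasure fun f => ?_
  have hrep : ∀ g ∈ repAlgebra N, ∫ U, g U ∂ρ = ∫ U, g U ∂ρ' := by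
    intro g hg
    obtain ⟨u, hu, h0⟩ := IsRepresentative.exists_isHeatSolution hg
    have e1 := h.integral_eq u hu
    have e2 := h'.integral_eq u hu
    rw [h0] at e1 e2
    rw [e1, e2]
  have hI : ∀ (μ : Measure (UN N)) [IsProbabilityMeasure μ] (g : C(UN N, ℝ)), Integrable g μ :=
    fun μ _ g => g.continuous.integrable_of_hasCompactSupport (HasCompactSupport.of_compactSpace _)
  have hclose : ∀ (μ : Measure (UN N)) [IsProbabilityMeasure μ] (a b : C(UN N, ℝ)),
      |∫ U, a U ∂μ - ∫ U, b U ∂μ| ≤ ‖a - b‖ := by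
    intro μ _ a b
    rw [← integral_sub (hI μ a) (hI μ b), ← Real.norm_eq_abs]
    have := norm_integral_le_of_norm_le_const (μ := μ) (f := fun U => a U - b U) (C := ‖a - b‖)
      (Eventually.of_forall fun U => (a - b).norm_coe_le_norm U)
    simpa using this
  have key : ∀ δ : ℝ, 0 < δ → |∫ U, f U ∂ρ - ∫ U, f U ∂ρ'| ≤ 0 + δ := by
    intro δ hδ
    obtain ⟨g, hg, hfg⟩ := exists_isRepresentative_near f.toContinuousMap (half_pos hδ)
    have h1 := hclose ρ f.toContinuousMap g
    have h2 := hclose ρ' g f.toContinuousMap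
    rw [norm_sub_rev] at h2
    rw [hrep g hg] at h1
    have h3 := abs_sub_le (∫ U, f U ∂ρ) (∫ U, g U ∂ρ') (∫ U, f U ∂ρ')
    have h1' : |∫ U, f U ∂ρ - ∫ U, g U ∂ρ'| ≤ ‖f.toContinuousMap - g‖ := h1
    have h2' : |∫ U, g U ∂ρ' - ∫ U, f U ∂ρ'| ≤ ‖f.toContinuousMap - g‖ := h2
    linarith
  have := le_of_forall_pos_le_add key
  rwa [abs_nonpos_iff, sub_eq_zero] at this

/-- The heat kernel measure `ρ_s` on the unitary group. -/
noncomputable def heatKernelMeasure (N : ℕ) (s : ℝ) (hs : 0 < s) : Measure (UN N) :=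
  Classical.choose (exists_isHeatKernelMeasure N hs.le)

theorem isHeatKernelMeasure_heatKernelMeasure (N : ℕ) (s : ℝ) (hs : 0 < s) :
    IsHeatKernelMeasure N s (heatKernelMeasure N s hs) :=
  Classical.choose_spec (exists_isHeatKernelMeasure N hs.le)

/-! ### Trace polynomials and equivariant functions -/

/-- The normalized trace `tr Z = (1/N) ∑ Z_nn`. -/
noncomputable def ntr {N : ℕ} (Z : Mat N) : ℂ := (1 / (N : ℂ)) * Matrix.trace Z

/-- The scaled Hilbert-Schmidt norm `‖Z‖ = (tr (Z Z*))^(1/2)`. -/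
noncomputable def hsNorm {N : ℕ} (Z : Mat N) : ℝ := Real.sqrt (ntr (Z * star Z)).re

/-- The algebra `ℂ[u, u⁻¹; v]`: Laurent polynomials in `u` whose coefficients are complex
polynomials in the commuting variables `v_k`, `k` a nonzero integer. -/
abbrev TracePoly : Type := LaurentPolynomial (MvPolynomial {k : ℤ // k ≠ 0} ℂ)

/-- The trace polynomial `P_N(Z)`, obtained from `P` by setting `u = Z` and `v_k = tr (Z^k)`. -/
noncomputable def tracePolyGL (N : ℕ) (P : TracePoly) (Z : Matrix.GeneralLinearGroup (Fin N) ℂ) :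
    Mat N :=
  P.coeff.sum fun (k : ℤ) (Q : MvPolynomial {k : ℤ // k ≠ 0} ℂ) =>
    MvPolynomial.aeval
      (fun j : {k : ℤ // k ≠ 0} =>
        ntr ((Z ^ (j : ℤ) : Matrix.GeneralLinearGroup (Fin N) ℂ) : Mat N)) Q •
      ((Z ^ k : Matrix.GeneralLinearGroup (Fin N) ℂ) : Mat N)

/-- The restriction of the trace polynomial `P_N` to the unitary group. -/
noncomputable def tracePolyU (N : ℕ) (P : TracePoly) (U : UN N) : Mat N :=
  tracePolyGL N P (Unitary.toUnits U)

/-- Equivariance under the adjoint action of the unitary group: `F(B A B⁻¹) = B F(A) B⁻¹`. -/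
def IsEquivariant {N : ℕ} (F : UN N → Mat N) : Prop :=
  ∀ A B : UN N, F (B * A * B⁻¹) = (B : Mat N) * F A * ((B⁻¹ : UN N) : Mat N)

/-- The norm of `L²(U(N), ρ_s; M_N)`: the `L²(ρ_s)`-norm of the scalar function `‖F‖`. -/
noncomputable def l2Norm (N : ℕ) (s : ℝ) (hs : 0 < s) (F : UN N → Mat N) : ℝ≥0∞ :=
  eLpNorm (fun U => hsNorm (F U)) 2 (heatKernelMeasure N s hs)

/-- The functions representing elements of `L²(U(N), ρ_s; M_N)_eq`: the (almost everywhere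
strongly) measurable equivariant functions `F` for which `‖F‖` belongs to `L²(ρ_s)`. -/
def equivariantL2 (N : ℕ) (s : ℝ) (hs : 0 < s) : Set (UN N → Mat N) :=
  {F | AEStronglyMeasurable F (heatKernelMeasure N s hs) ∧
    MemLp (fun U => hsNorm (F U)) 2 (heatKernelMeasure N s hs) ∧ IsEquivariant F}

end UnitaryHeat

namespace UnitaryHeat

open scoped Matrix

/-! ### Unitary matrices up to conjugation -/

/-! The only property of the heat kernel measure that matters is that it is a Borel probability
measure `ρ` on a compact pseudometrizable group. The proof splits into a pointwise, algebraic part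
and a measure-theoretic part.

Pointwise: if `B` commutes with `A`, equivariance gives `B F(A) B⁻¹ = F(A)`. So `F(A)` commutes with
the unitary centralizer of `A`, and after diagonalizing `A` this forces `F(A)` to be a polynomial in
`A` of degree less than `N`, with coefficients depending on `A` (`IsEquivariant.exists_eq_sum_pow`).

The coefficients need not be selected measurably. Up to an error `η` they may be taken from a
countable dense set, and the first index that works is a conjugation-invariant function of `A`,
because the norm of an equivariant function is constant on conjugacy classes. Hence `F` is uniformly
`η`-close to a countable sum of functions `1_S P`, with `P` a trace polynomial and `S` an invariant
set; absolute continuity of the integral cuts this to a finite sum.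

It remains to approximate one `1_S P` (`isTracePolyLimit_indicator`). Compact sets `K` in `S` and
`L` in its complement exhaust both up to small measure. Power traces separate conjugacy classes, so
the images of `K` and `L` under `powerTraces` are disjoint. Urysohn's lemma on the compact range of
`powerTraces` replaces `1_S` by a continuous function of the traces, and Stone–Weierstrass replaces
that by a polynomial in them. -/

theorem coe_inv {N : ℕ} (B : UN N) : ((B⁻¹ : UN N) : Mat N) = star (B : Mat N) := rfl

/-- The unit circle is connected with more than one point, hence infinite, while the characteristic
polynomial has finitely many roots. Such a `w` is a base point at which the Cayley transform of `A`
is defined. -/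
theorem exists_norm_one_det_sub_ne_zero {N : ℕ} (A : Mat N) :
    ∃ w : ℂ, ‖w‖ = 1 ∧ (Matrix.scalar (Fin N) w - A).det ≠ 0 := by
  have hinf : (Metric.sphere (0 : ℂ) 1).Infinite := by
    refine (isPreconnected_sphere (by simp [Complex.rank_real_complex]) 0 1).infinite_of_nontrivial
      ⟨1, by simp, -1, by simp, ?_⟩
    norm_num [Complex.ext_iff]
  have hfin : {w : ℂ | A.charpoly.IsRoot w}.Finite :=
    Polynomial.finite_setOfPred_isRoot A.charpoly_monic.ne_zero
  obtain ⟨w, hw, hr⟩ := (hinf.sdiff hfin).nonempty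
  refine ⟨w, by simpa using hw, fun h => hr ?_⟩
  rw [mem_ofPred_eq, Polynomial.IsRoot, Matrix.eval_charpoly, h]

/-- The Cayley transform of a unitary matrix is Hermitian. -/
theorem isHermitian_cayley {N : ℕ} (A : UN N) {w : ℂ} (hw : ‖w‖ = 1)
    (hdet : (Matrix.scalar (Fin N) w - (A : Mat N)).det ≠ 0) :
    (Complex.I • ((Matrix.scalar (Fin N) w + (A : Mat N)) *
      (Matrix.scalar (Fin N) w - (A : Mat N))⁻¹)).IsHermitian := by
  set S : Mat N := Matrix.scalar (Fin N) w - (A : Mat N) with hS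
  have hu : IsUnit S.det := isUnit_iff_ne_zero.mpr hdet
  have hu' : IsUnit Sᴴ.det := by
    rw [Matrix.det_conjTranspose]
    exact hu.star
  have hAA : star (A : Mat N) * (A : Mat N) = 1 := Matrix.UnitaryGroup.star_mul_self A
  have hww : (starRingEnd ℂ) w * w = 1 := by
    rw [Complex.conj_mul', hw]
    norm_num
  have hI : w * (-Complex.I * (starRingEnd ℂ) w) = -Complex.I := by
    linear_combination (-Complex.I) * hww
  have hI' : Complex.I * (w * (starRingEnd ℂ) w) = Complex.I := by
    linear_combination Complex.I * hww
  have hscal : (Matrix.scalar (Fin N) w : Mat N)ᴴ = Matrix.scalar (Fin N) ((starRingEnd ℂ) w) := by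
    ext i j
    rcases eq_or_ne i j with rfl | h
    · simp [Matrix.scalar_apply]
    · simp [Matrix.scalar_apply, h, h.symm]
  have hsm : ∀ (z : ℂ), (Matrix.scalar (Fin N) z : Mat N) = z • (1 : Mat N) := fun z => by
    rw [Matrix.smul_one_eq_diagonal]; rfl
  have e1 : (Matrix.scalar (Fin N) w + (A : Mat N)) * S⁻¹ * S =
      Matrix.scalar (Fin N) w + (A : Mat N) := by
    rw [mul_assoc, Matrix.nonsing_inv_mul _ hu, mul_one]
  -- Multiplying by `Sᴴ` and `S` clears both inverses. With `A* A = 1` and `|w| = 1`, both sides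
  -- become `i (w̄ A - w A*)`.
  have key : Sᴴ * (Complex.I • ((Matrix.scalar (Fin N) w + (A : Mat N)) * S⁻¹))ᴴ * S =
      Sᴴ * (Complex.I • ((Matrix.scalar (Fin N) w + (A : Mat N)) * S⁻¹)) * S := by
    have e2 : Sᴴ * (Complex.I • ((Matrix.scalar (Fin N) w + (A : Mat N)) * S⁻¹))ᴴ =
        (Complex.I • (Matrix.scalar (Fin N) w + (A : Mat N)))ᴴ := by
      rw [← Matrix.conjTranspose_mul, smul_mul_assoc, e1]
    rw [e2, mul_assoc, smul_mul_assoc, e1, hS, Matrix.conjTranspose_smul, Matrix.conjTranspose_add,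
      Matrix.conjTranspose_sub, hscal, ← Matrix.star_eq_conjTranspose]
    simp only [hsm, Complex.star_def, Complex.conj_I, mul_smul_comm, smul_mul_assoc, add_mul,
      mul_add, sub_mul, mul_sub, one_mul, mul_one, hAA, smul_add, smul_sub, smul_smul, mul_assoc]
    rw [hI, hI']
    module
  have h1 := congrArg (fun Z => Sᴴ⁻¹ * Z * S⁻¹) key
  rw [Matrix.IsHermitian]
  simpa only [mul_assoc, Matrix.mul_nonsing_inv _ hu, mul_one, ← mul_assoc Sᴴ⁻¹,
    Matrix.nonsing_inv_mul _ hu', one_mul] using h1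

/-- Unitary matrices are unitarily diagonalizable. -/
theorem exists_eq_conj_diagonal {N : ℕ} (A : UN N) :
    ∃ (V D : UN N) (d : Fin N → ℂ), (D : Mat N) = Matrix.diagonal d ∧ A = V * D * V⁻¹ := by
  -- The eigenvector basis of the Hermitian Cayley transform `H` also diagonalizes `A`, thanks to
  -- the relation `H (w - A) = i (w + A)`.
  obtain ⟨w, hw, hdet⟩ := exists_norm_one_det_sub_ne_zero (A : Mat N)
  have hH := isHermitian_cayley A hw hdet
  set S : Mat N := Matrix.scalar (Fin N) w - (A : Mat N) with hS
  set H : Mat N := Complex.I • ((Matrix.scalar (Fin N) w + (A : Mat N)) * S⁻¹) with hHdef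
  have hHS : H * S = Complex.I • (Matrix.scalar (Fin N) w + (A : Mat N)) := by
    rw [hHdef, smul_mul_assoc, mul_assoc, Matrix.nonsing_inv_mul _ (isUnit_iff_ne_zero.mpr hdet),
      mul_one]
  set V : UN N := hH.eigenvectorUnitary
  set lam := hH.eigenvalues
  set L : Mat N := Matrix.diagonal (RCLike.ofReal ∘ lam)
  have hspec : H = (V : Mat N) * L * star (V : Mat N) := by
    conv_lhs => rw [hH.spectral_theorem, Unitary.conjStarAlgAut_apply]
  have hVV : star (V : Mat N) * (V : Mat N) = 1 := Matrix.UnitaryGroup.star_mul_self V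
  let D : UN N := V⁻¹ * A * V
  have hD : (D : Mat N) = star (V : Mat N) * (A : Mat N) * (V : Mat N) := rfl
  have hsc : ∀ (z : ℂ), star (V : Mat N) * Matrix.scalar (Fin N) z * (V : Mat N) =
      Matrix.scalar (Fin N) z := fun z => by
    rw [mul_assoc, (Matrix.scalar_commute z (fun _ => Commute.all _ _) (V : Mat N)).eq, ← mul_assoc,
      hVV, one_mul]
  have hrel : L * (Matrix.scalar (Fin N) w - (D : Mat N)) =
      Complex.I • (Matrix.scalar (Fin N) w + (D : Mat N)) := by
    have h1 := congrArg (fun Z => star (V : Mat N) * Z * (V : Mat N)) hHS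
    simp only [mul_smul_comm, smul_mul_assoc, mul_add, add_mul, hsc, ← hD] at h1
    rw [← h1, hspec, hS, hD]
    nth_rewrite 1 [← hsc w]
    rw [← sub_mul, ← mul_sub]
    simp only [← mul_assoc, hVV, one_mul]
  have hoff : ∀ i j, i ≠ j → (D : Mat N) i j = 0 := by
    intro i j hij
    have h1 := congrFun (congrFun hrel i) j
    simp only [L, Matrix.diagonal_mul, Matrix.sub_apply, Matrix.smul_apply, Matrix.add_apply,
      Matrix.scalar_apply, Matrix.diagonal_apply_ne _ hij, zero_sub, zero_add, smul_eq_mul,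
      Function.comp_apply] at h1
    -- The eigenvalue `lam i` is real, so `lam i + i` cannot vanish.
    have h2 : ((lam i : ℂ) + Complex.I) * (D : Mat N) i j = 0 := by
      have : ((lam i : ℂ)) * -(D : Mat N) i j = Complex.I * (D : Mat N) i j := h1
      linear_combination -this
    rcases mul_eq_zero.mp h2 with h | h
    · have := congrArg Complex.im h
      simp at this
    · exact h
  refine ⟨V, D, fun i => (D : Mat N) i i, ?_, by simp only [D]; group⟩
  ext i j
  by_cases h : i = j
  · subst h; simp
  · rw [hoff i j h, Matrix.diagonal_apply_ne _ h]

/-- Families of numbers with the same power sums agree up to a permutation. -/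
theorem exists_perm_of_sum_pow_eq {ι : Type*} [Fintype ι] [DecidableEq ι] {d e : ι → ℂ}
    (h : ∀ k : ℕ, ∑ i, d i ^ k = ∑ i, e i ^ k) : ∃ σ : Equiv.Perm ι, e = d ∘ σ := by
  have hp : ∀ p : Polynomial ℂ, ∑ i, p.eval (d i) = ∑ i, p.eval (e i) := fun p => by
    simp only [Polynomial.eval_eq_sum_range]
    rw [Finset.sum_comm, Finset.sum_comm (s := Finset.univ)]
    simp only [← Finset.mul_sum, h]
  have hcard : ∀ z : ℂ, Fintype.card {i // e i = z} = Fintype.card {i // d i = z} := by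
    intro z
    let s : Finset ℂ := insert z (Finset.univ.image d ∪ Finset.univ.image e)
    -- On all values of `d` and `e`, `p` is the indicator of `z`; summing `p` over a family counts
    -- how often `z` occurs in it.
    let p : Polynomial ℂ := Lagrange.interpolate s id (Pi.single z 1)
    have hev : ∀ x ∈ s, p.eval x = if x = z then 1 else 0 := fun x hx => by
      rw [show p.eval x = p.eval (id x) from rfl,
        Lagrange.eval_interpolate_at_node _ (injOn_id _) hx, Pi.single_apply]
    have h1 := hp p
    rw [Finset.sum_congr rfl fun i _ => hev (d i) (by simp [s]),
      Finset.sum_congr rfl fun i _ => hev (e i) (by simp [s]), Finset.sum_boole,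
      Finset.sum_boole] at h1
    rw [Fintype.card_subtype, Fintype.card_subtype]
    exact_mod_cast h1.symm
  -- Bijections between the fibres of `e` and `d` over each `z` glue to a permutation.
  let eqv := fun z => Fintype.equivOfCardEq (hcard z)
  refine ⟨(Equiv.sigmaFiberEquiv e).symm.trans ((Equiv.sigmaCongrRight eqv).trans
    (Equiv.sigmaFiberEquiv d)), ?_⟩
  funext i
  exact (eqv (e i) ⟨i, rfl⟩).2.symm

/-- A permutation matrix as a unitary matrix. -/
noncomputable def permU {N : ℕ} (σ : Equiv.Perm (Fin N)) : UN N :=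
  ⟨σ.permMatrix ℂ, by
    rw [Matrix.mem_unitaryGroup_iff, Matrix.star_eq_conjTranspose, Matrix.conjTranspose_permMatrix,
      ← Matrix.permMatrix_mul, inv_mul_cancel, Matrix.permMatrix_one]⟩

theorem permU_conj_apply {N : ℕ} (σ : Equiv.Perm (Fin N)) (Z : Mat N) (i j : Fin N) :
    ((permU σ : Mat N) * Z * ((permU σ)⁻¹ : UN N)) i j = Z (σ i) (σ j) := by
  rw [coe_inv]
  simp only [permU, Matrix.star_eq_conjTranspose, Matrix.conjTranspose_permMatrix,
    Equiv.Perm.permMatrix, PEquiv.toMatrix_toPEquiv_mul, PEquiv.mul_toMatrix_toPEquiv]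
  rfl

theorem coe_conj_pow {N : ℕ} (V D : UN N) (k : ℕ) :
    ((V * D * V⁻¹ : UN N) : Mat N) ^ k = (V : Mat N) * (D : Mat N) ^ k * ((V⁻¹ : UN N) : Mat N) := by
  have : (V * D * V⁻¹) ^ k = V * D ^ k * V⁻¹ := conj_pow
  exact congrArg (Subtype.val : UN N → Mat N) this

theorem trace_conj {N : ℕ} (V : UN N) (Z : Mat N) :
    Matrix.trace ((V : Mat N) * Z * ((V⁻¹ : UN N) : Mat N)) = Matrix.trace Z := by
  rw [Matrix.trace_mul_cycle, coe_inv, Matrix.UnitaryGroup.star_mul_self, one_mul]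

/-- Unitary matrices whose powers have the same traces are unitarily conjugate. -/
theorem exists_conj_of_trace_pow_eq {N : ℕ} {A B : UN N}
    (h : ∀ k : ℕ, Matrix.trace ((A : Mat N) ^ k) = Matrix.trace ((B : Mat N) ^ k)) :
    ∃ W : UN N, B = W * A * W⁻¹ := by
  obtain ⟨V, D, d, hD, rfl⟩ := exists_eq_conj_diagonal A
  obtain ⟨V', E, e, hE, rfl⟩ := exists_eq_conj_diagonal B
  simp only [coe_conj_pow, trace_conj, hD, hE, Matrix.diagonal_pow, Matrix.trace_diagonal,
    Pi.pow_apply] at h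
  obtain ⟨σ, hσ⟩ := exists_perm_of_sum_pow_eq h
  have hEσ : E = permU σ * D * (permU σ)⁻¹ := by
    apply Subtype.ext
    ext i j
    have := permU_conj_apply σ (D : Mat N) i j
    rw [hD] at this
    rw [hE, hσ]
    refine Eq.trans ?_ (by simpa [hD] using this.symm)
    simp [Matrix.diagonal_apply]
  refine ⟨V' * permU σ * V⁻¹, ?_⟩
  rw [hEσ]
  group

/-! ### Values of equivariant functions as polynomials -/

/-- A diagonal sign matrix as a unitary matrix. -/
noncomputable def signU {N : ℕ} (i : Fin N) : UN N :=
  ⟨Matrix.diagonal (Function.update 1 i (-1)), by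
    rw [Matrix.mem_unitaryGroup_iff, Matrix.star_eq_conjTranspose, Matrix.diagonal_conjTranspose,
      Matrix.diagonal_mul_diagonal, ← Matrix.diagonal_one]
    congr 1
    funext j
    by_cases h : j = i <;> simp [h]⟩

/-- A matrix which commutes with every unitary matrix commuting with a diagonal unitary matrix `D`
is a polynomial in `D`. -/
theorem exists_eq_sum_diagonal_pow {N : ℕ} (hN : 0 < N) {D : UN N} {d : Fin N → ℂ}
    (hD : (D : Mat N) = Matrix.diagonal d) {Z : Mat N}
    (hZ : ∀ B : UN N, B * D * B⁻¹ = D → (B : Mat N) * Z * ((B⁻¹ : UN N) : Mat N) = Z) :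
    ∃ c : Fin N → ℂ, Z = ∑ k, c k • (D : Mat N) ^ (k : ℕ) := by
  -- `signU i` is diagonal, so it commutes with `D`; conjugation by it changes the sign of `Z i j`.
  have hoff : ∀ i j, i ≠ j → Z i j = 0 := by
    intro i j hij
    have hc : signU i * D * (signU i)⁻¹ = D := by
      rw [mul_inv_eq_iff_eq_mul]
      apply Subtype.ext
      change (signU i : Mat N) * (D : Mat N) = (D : Mat N) * (signU i : Mat N)
      rw [hD]
      simp [signU, Matrix.diagonal_mul_diagonal, mul_comm]
    have h1 := congrFun (congrFun (hZ _ hc) i) j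
    rw [coe_inv] at h1
    simp [signU, Matrix.star_eq_conjTranspose, Matrix.diagonal_conjTranspose, Ne.symm hij] at h1
    linear_combination (-1 / 2 : ℂ) * h1
  -- The transposition of two equal eigenvalues fixes `D` and exchanges the two diagonal entries of
  -- `Z`.
  have hdiag : ∀ i j, d i = d j → Z i i = Z j j := by
    intro i j hij
    have hc : permU (Equiv.swap i j) * D * (permU (Equiv.swap i j))⁻¹ = D := by
      apply Subtype.ext
      ext a b
      refine (permU_conj_apply (Equiv.swap i j) (D : Mat N) a b).trans ?_
      have hd : ∀ a, d (Equiv.swap i j a) = d a := fun a => by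
        rw [Equiv.swap_apply_def]; split_ifs <;> simp_all
      simp [hD, Matrix.diagonal_apply, hd]
    have h1 := congrFun (congrFun (hZ _ hc) i) i
    rw [permU_conj_apply, Equiv.swap_apply_left] at h1
    exact h1.symm
  let s : Finset ℂ := Finset.univ.image d
  -- By `hdiag` the diagonal of `Z` is a function `r` of the eigenvalue. Interpolating `r` at the at
  -- most `N` distinct eigenvalues gives degree less than `N`.
  let r : ℂ → ℂ := fun z => if h : ∃ i, d i = z then Z h.choose h.choose else 0
  have hr : ∀ i, r (d i) = Z i i := fun i => by
    have h : ∃ j, d j = d i := ⟨i, rfl⟩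
    simp only [r, dif_pos h]
    exact hdiag _ _ h.choose_spec
  let p : Polynomial ℂ := Lagrange.interpolate s id r
  have hp : ∀ i, p.eval (d i) = Z i i := fun i => by
    rw [show p.eval (d i) = p.eval (id (d i)) from rfl,
      Lagrange.eval_interpolate_at_node _ (injOn_id _) (by simp [s])]
    exact hr i
  have hdeg : p.degree < N := (Lagrange.degree_interpolate_lt r (injOn_id _)).trans_le (by
    have : s.card ≤ N := Finset.card_image_le.trans (by simp)
    exact_mod_cast this)
  refine ⟨fun k => p.coeff k, ?_⟩
  have hnat : p.natDegree < N := by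
    -- The zero polynomial has `natDegree` equal to `0`, so this case needs `0 < N`.
    rcases eq_or_ne p 0 with h0 | h0
    · rw [h0, Polynomial.natDegree_zero]
      exact hN
    · exact (Polynomial.natDegree_lt_iff_degree_lt h0).mpr hdeg
  ext i j
  have happ : ∀ k : ℕ, (Matrix.diagonal d ^ k) i j = if i = j then d i ^ k else 0 := fun k => by
    rw [Matrix.diagonal_pow, Matrix.diagonal_apply, Pi.pow_apply]
  simp only [hD, Matrix.sum_apply, Matrix.smul_apply, happ]
  by_cases h : i = j
  · subst h
    rw [← hp, Polynomial.eval_eq_sum_range' hnat, Finset.sum_range]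
    simp
  · rw [hoff i j h]
    simp [h]

/-- The value of an equivariant function at a unitary matrix is a polynomial in this matrix. -/
theorem IsEquivariant.exists_eq_sum_pow {N : ℕ} (hN : 0 < N) {F : UN N → Mat N} (hF : IsEquivariant F)
    (A : UN N) : ∃ c : Fin N → ℂ, F A = ∑ k, c k • (A : Mat N) ^ (k : ℕ) := by
  obtain ⟨V, D, d, hD, rfl⟩ := exists_eq_conj_diagonal A
  obtain ⟨c, hc⟩ := exists_eq_sum_diagonal_pow hN hD (Z := F D) fun B hB => by rw [← hF, hB]
  refine ⟨c, ?_⟩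
  rw [hF, hc, Finset.mul_sum, Finset.sum_mul]
  refine Finset.sum_congr rfl fun k _ => ?_
  rw [coe_conj_pow, mul_smul_comm, smul_mul_assoc]

/-! ### The normalized Hilbert-Schmidt norm -/

theorem hsNorm_eq_sqrt_sum {N : ℕ} (Z : Mat N) :
    hsNorm Z = Real.sqrt (1 / N * ∑ i, ∑ j, ‖Z i j‖ ^ 2) := by
  have h : Matrix.trace (Z * star Z) = ((∑ i, ∑ j, ‖Z i j‖ ^ 2 : ℝ) : ℂ) := by
    simp [Matrix.trace, Matrix.mul_apply, Complex.mul_conj', Matrix.star_apply]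
  rw [hsNorm, ntr, h, ← Complex.ofReal_natCast, ← Complex.ofReal_one, ← Complex.ofReal_div,
    ← Complex.ofReal_mul, Complex.ofReal_re]

theorem hsNorm_nonneg {N : ℕ} (Z : Mat N) : 0 ≤ hsNorm Z := Real.sqrt_nonneg _

theorem continuous_hsNorm {N : ℕ} : Continuous (hsNorm : Mat N → ℝ) := by
  rw [show (hsNorm : Mat N → ℝ) = _ from funext hsNorm_eq_sqrt_sum]
  have : ∀ i j, Continuous fun Z : Mat N => Z i j := fun i j => continuous_id.matrix_elem i j
  fun_prop

section Frobenius

attribute [local instance] Matrix.frobeniusNormedAddCommGroup Matrix.frobeniusNormedSpace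

/-- Source of the triangle inequality and homogeneity for `hsNorm`. -/
theorem hsNorm_eq_frobenius {N : ℕ} (Z : Mat N) : hsNorm Z = Real.sqrt (1 / N) * ‖Z‖ := by
  rw [hsNorm_eq_sqrt_sum, Real.sqrt_mul (by positivity), Matrix.frobenius_norm_def,
    Real.sqrt_eq_rpow (∑ i, ∑ j, ‖Z i j‖ ^ 2)]
  simp only [Real.rpow_two]

theorem hsNorm_add_le {N : ℕ} (Y Z : Mat N) : hsNorm (Y + Z) ≤ hsNorm Y + hsNorm Z := by
  rw [hsNorm_eq_frobenius, hsNorm_eq_frobenius, hsNorm_eq_frobenius, ← mul_add]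
  exact mul_le_mul_of_nonneg_left (norm_add_le Y Z) (Real.sqrt_nonneg _)

theorem hsNorm_smul {N : ℕ} (c : ℂ) (Z : Mat N) : hsNorm (c • Z) = ‖c‖ * hsNorm Z := by
  rw [hsNorm_eq_frobenius, hsNorm_eq_frobenius, norm_smul]
  ring

end Frobenius

theorem hsNorm_zero {N : ℕ} : hsNorm (0 : Mat N) = 0 := by
  simpa using hsNorm_smul (0 : ℂ) (0 : Mat N)

theorem hsNorm_sub_le {N : ℕ} (X Y Z : Mat N) : hsNorm (X - Z) ≤ hsNorm (X - Y) + hsNorm (Y - Z) := by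
  simpa using hsNorm_add_le (X - Y) (Y - Z)

theorem hsNorm_conj {N : ℕ} (V : UN N) (Z : Mat N) :
    hsNorm ((V : Mat N) * Z * ((V⁻¹ : UN N) : Mat N)) = hsNorm Z := by
  have h : (V : Mat N) * Z * ((V⁻¹ : UN N) : Mat N) *
      star ((V : Mat N) * Z * ((V⁻¹ : UN N) : Mat N)) =
      (V : Mat N) * (Z * star Z) * ((V⁻¹ : UN N) : Mat N) := by
    have hVV : star (V : Mat N) * (V : Mat N) = 1 := Matrix.UnitaryGroup.star_mul_self V
    simp only [coe_inv, star_mul, star_star, mul_assoc]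
    rw [← mul_assoc (star (V : Mat N)), hVV, one_mul]
  rw [hsNorm, hsNorm, ntr, ntr, h, trace_conj]

/-! ### Trace polynomials on the unitary group -/

/-- The normalized traces of the powers of a unitary matrix. -/
noncomputable def powerTraces {N : ℕ} (U : UN N) (j : {k : ℤ // k ≠ 0}) : ℂ :=
  ntr ((U ^ (j : ℤ) : UN N) : Mat N)

theorem tracePolyU_eq {N : ℕ} (P : TracePoly) (U : UN N) :
    tracePolyU N P U = P.coeff.sum fun k Q =>
      MvPolynomial.aeval (powerTraces U) Q • ((U ^ k : UN N) : Mat N) := by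
  have h : ∀ k : ℤ, ((Unitary.toUnits U ^ k : Matrix.GeneralLinearGroup (Fin N) ℂ) : Mat N) =
      ((U ^ k : UN N) : Mat N) := fun k =>
    congrArg Units.val (map_zpow (Unitary.toUnits : UN N →* (Mat N)ˣ) U k).symm
  simp only [tracePolyU, tracePolyGL, h]
  rfl

theorem tracePolyU_add {N : ℕ} (P P' : TracePoly) (U : UN N) :
    tracePolyU N (P + P') U = tracePolyU N P U + tracePolyU N P' U := by
  simp only [tracePolyU_eq, AddMonoidAlgebra.coeff_add]
  exact Finsupp.sum_add_index' (fun _ => by simp) fun _ _ _ => by simp [add_smul]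

theorem tracePolyU_single {N : ℕ} (k : ℤ) (Q : MvPolynomial {k : ℤ // k ≠ 0} ℂ) (U : UN N) :
    tracePolyU N (AddMonoidAlgebra.single k Q) U =
      MvPolynomial.aeval (powerTraces U) Q • ((U ^ k : UN N) : Mat N) := by
  rw [tracePolyU_eq, AddMonoidAlgebra.coeff_single]
  exact Finsupp.sum_single_index (by simp)

theorem tracePolyU_zero {N : ℕ} (U : UN N) : tracePolyU N 0 U = 0 := by
  rw [tracePolyU_eq]
  simp

theorem tracePolyU_sum {N : ℕ} {ι : Type*} (s : Finset ι) (P : ι → TracePoly) (U : UN N) :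
    tracePolyU N (∑ i ∈ s, P i) U = ∑ i ∈ s, tracePolyU N (P i) U :=
  map_sum (AddMonoidHom.mk' (fun P => tracePolyU N P U) fun P P' => tracePolyU_add P P' U) P s

/-- Trace polynomials form a module over the polynomials in the traces, so a scalar factor may be
approximated on its own. -/
theorem tracePolyU_C_mul {N : ℕ} (Q : MvPolynomial {k : ℤ // k ≠ 0} ℂ) (P : TracePoly) (U : UN N) :
    tracePolyU N (LaurentPolynomial.C Q * P) U =
      MvPolynomial.aeval (powerTraces U) Q • tracePolyU N P U := by
  induction P using AddMonoidAlgebra.induction_linear with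
  | zero => rw [mul_zero, tracePolyU_zero, smul_zero]
  | add P P' h h' => rw [mul_add, tracePolyU_add, tracePolyU_add, h, h', smul_add]
  | single k R =>
    rw [tracePolyU_single, show LaurentPolynomial.C Q = AddMonoidAlgebra.single 0 Q from rfl,
      AddMonoidAlgebra.single_mul_single, tracePolyU_single, map_mul, zero_add, mul_smul]

theorem continuous_coe_zpow {N : ℕ} (k : ℤ) :
    Continuous fun U : UN N => ((U ^ k : UN N) : Mat N) :=
  continuous_subtype_val.comp (continuous_zpow k)

theorem continuous_powerTraces {N : ℕ} : Continuous (powerTraces : UN N → _) :=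
  continuous_pi fun j => continuous_const.mul (continuous_coe_zpow (j : ℤ)).matrix_trace

theorem continuous_tracePolyU {N : ℕ} (P : TracePoly) : Continuous (tracePolyU N P) := by
  rw [show tracePolyU N P = _ from funext (tracePolyU_eq P)]
  refine continuous_finsetSum _ fun k _ =>
    Continuous.smul (f := fun U => MvPolynomial.aeval (powerTraces U) (P.coeff k)) ?_
      (continuous_coe_zpow k)
  simp only [MvPolynomial.aeval_def, MvPolynomial.eval₂_eq]
  refine continuous_finsetSum _ fun m _ => continuous_const.mul
    (continuous_finsetProd _ fun i _ => Continuous.pow ?_ _)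
  exact (continuous_apply i).comp continuous_powerTraces

theorem powerTraces_conj {N : ℕ} (A B : UN N) : powerTraces (B * A * B⁻¹) = powerTraces A := by
  funext j
  have h : (B * A * B⁻¹) ^ (j : ℤ) = B * A ^ (j : ℤ) * B⁻¹ := conj_zpow
  rw [powerTraces, powerTraces, h, ntr, ntr]
  exact congrArg _ (trace_conj B _)

theorem isEquivariant_tracePolyU {N : ℕ} (P : TracePoly) : IsEquivariant (tracePolyU N P) := by
  intro A B
  have h : ∀ k : ℤ, (((B * A * B⁻¹) ^ k : UN N) : Mat N) =
      (B : Mat N) * ((A ^ k : UN N) : Mat N) * ((B⁻¹ : UN N) : Mat N) := fun k =>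
    congrArg (Subtype.val : UN N → Mat N) (conj_zpow : (B * A * B⁻¹) ^ k = B * A ^ k * B⁻¹)
  simp only [tracePolyU_eq, powerTraces_conj, h, Finsupp.sum, Finset.mul_sum, Finset.sum_mul,
    mul_smul_comm, smul_mul_assoc]

/-- Unitary matrices with the same power traces are unitarily conjugate. -/
theorem exists_conj_of_powerTraces_eq {N : ℕ} (hN : 0 < N) {A B : UN N}
    (h : powerTraces A = powerTraces B) : ∃ W : UN N, B = W * A * W⁻¹ := by
  refine exists_conj_of_trace_pow_eq fun k => ?_
  -- The exponent `0` is not among the indices of `powerTraces`, but both zeroth powers are the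
  -- identity.
  rcases eq_or_ne k 0 with rfl | hk
  · simp
  · have h1 := congrFun h ⟨k, by exact_mod_cast hk⟩
    have hN' : (1 / (N : ℂ)) ≠ 0 := one_div_ne_zero (by exact_mod_cast hN.ne')
    have h2 := mul_left_cancel₀ hN' h1
    simp only [zpow_natCast] at h2
    exact h2

theorem exists_hsNorm_le {N : ℕ} {G : UN N → Mat N} (hG : Continuous G) :
    ∃ C : ℝ, 0 ≤ C ∧ ∀ U, hsNorm (G U) ≤ C := by
  obtain ⟨C, hC⟩ := (isCompact_range (continuous_hsNorm.comp hG)).bddAbove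
  exact ⟨C, (hsNorm_nonneg _).trans (hC ⟨1, rfl⟩), fun U => hC ⟨U, rfl⟩⟩

/-! ### Approximation of continuous class functions -/

/-- For `N > 0` this range is a model of the space of conjugacy classes; Urysohn's lemma and
Stone–Weierstrass are applied on it. -/
instance compactSpace_range_powerTraces (N : ℕ) :
    CompactSpace (range (powerTraces : UN N → {k : ℤ // k ≠ 0} → ℂ)) :=
  isCompact_iff_compactSpace.mp (isCompact_range continuous_powerTraces)

/-- Since `U⁻¹ = U*`, the variables with negative index supply the complex conjugates. This makes
the algebra generated by the traces self-adjoint, as complex Stone–Weierstrass demands. -/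
theorem powerTraces_neg {N : ℕ} (U : UN N) (j : {k : ℤ // k ≠ 0}) :
    powerTraces U ⟨-j, neg_ne_zero.mpr j.2⟩ = star (powerTraces U j) := by
  have h : ((U ^ (-(j : ℤ)) : UN N) : Mat N) = star ((U ^ (j : ℤ) : UN N) : Mat N) := by
    rw [zpow_neg, coe_inv]
  simp only [powerTraces, h, ntr, Matrix.star_eq_conjTranspose, Matrix.trace_conjTranspose, star_mul',
    star_div₀, star_one, star_natCast]

/-- Continuous functions of the power traces are uniform limits of polynomials in them. -/
theorem exists_aeval_powerTraces_near {N : ℕ}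
    (φ : C(range (powerTraces : UN N → {k : ℤ // k ≠ 0} → ℂ), ℂ)) {ε : ℝ} (hε : 0 < ε) :
    ∃ Q : MvPolynomial {k : ℤ // k ≠ 0} ℂ, ∀ U : UN N,
      ‖φ (rangeFactorization powerTraces U) - MvPolynomial.aeval (powerTraces U) Q‖ < ε := by
  let X := range (powerTraces : UN N → {k : ℤ // k ≠ 0} → ℂ)
  let coord : {k : ℤ // k ≠ 0} → C(X, ℂ) := fun j =>
    ⟨fun x => x.1 j, (continuous_apply j).comp continuous_subtype_val⟩
  have hstar : ∀ f ∈ Algebra.adjoin ℂ (range coord), star f ∈ Algebra.adjoin ℂ (range coord) := by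
    intro f hf
    induction hf using Algebra.adjoin_induction with
    | mem f hf =>
      obtain ⟨j, rfl⟩ := hf
      have : star (coord j) = coord ⟨-j, neg_ne_zero.mpr j.2⟩ := by
        ext ⟨_, U, rfl⟩
        exact (powerTraces_neg U j).symm
      rw [this]
      exact Algebra.subset_adjoin ⟨_, rfl⟩
    | algebraMap c =>
      rw [← algebraMap_star_comm]
      exact Subalgebra.algebraMap_mem _ _
    | add f g _ _ hf hg => rw [star_add]; exact add_mem hf hg
    | mul f g _ _ hf hg => rw [star_mul]; exact mul_mem hg hf
  let 𝒜 : StarSubalgebra ℂ C(X, ℂ) := { Algebra.adjoin ℂ (range coord) with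
    star_mem' := fun {f} hf => hstar f hf }
  have hsep : 𝒜.SeparatesPoints := by
    intro x y hxy
    by_contra! hcon
    exact hxy (Subtype.ext (funext fun j =>
      hcon _ ⟨coord j, Algebra.subset_adjoin ⟨j, rfl⟩, rfl⟩))
  have htop := ContinuousMap.starSubalgebra_topologicalClosure_eq_top_of_separatesPoints 𝒜 hsep
  have hmem : φ ∈ 𝒜.topologicalClosure := by rw [htop]; trivial
  rw [← SetLike.mem_coe, StarSubalgebra.topologicalClosure_coe, Metric.mem_closure_iff] at hmem
  obtain ⟨g, hg, hd⟩ := hmem ε hε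
  have hg' : g ∈ Algebra.adjoin ℂ (range coord) := hg
  rw [Algebra.adjoin_range_eq_range_aeval] at hg'
  obtain ⟨Q, rfl⟩ := hg'
  refine ⟨Q, fun U => ?_⟩
  -- Evaluation at a point is an algebra homomorphism, so it commutes with substitution into `Q`.
  have hev : MvPolynomial.aeval (powerTraces U) Q =
      (MvPolynomial.aeval coord Q : C(X, ℂ)) (rangeFactorization powerTraces U) := by
    have := MvPolynomial.map_aeval coord
      ((ContinuousMap.evalAlgHom ℂ ℂ (rangeFactorization powerTraces U) : C(X, ℂ) →ₐ[ℂ] ℂ) :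
        C(X, ℂ) →+* ℂ) Q
    refine Eq.trans ?_ this.symm
    rw [MvPolynomial.aeval_def]
    congr 1
  rw [hev]
  rw [dist_eq_norm] at hd
  exact ((φ - MvPolynomial.aeval coord Q).norm_coe_le_norm _).trans_lt hd

/-! ### Approximation in the mean -/

instance pseudoMetrizableSpace_mat (N : ℕ) : TopologicalSpace.PseudoMetrizableSpace (Mat N) :=
  inferInstanceAs (TopologicalSpace.PseudoMetrizableSpace (Fin N → Fin N → ℂ))

instance secondCountableTopology_mat (N : ℕ) : SecondCountableTopology (Mat N) :=
  inferInstanceAs (SecondCountableTopology (Fin N → Fin N → ℂ))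

/-- Finite Borel measures on a compact pseudometrizable space are inner regular with respect to
compact sets. -/
instance pseudoMetrizableSpace_UN (N : ℕ) : TopologicalSpace.PseudoMetrizableSpace (UN N) :=
  Topology.IsInducing.subtypeVal.pseudoMetrizableSpace

/-- Every null-measurable set is exhausted by compact subsets up to small measure. -/
theorem exists_isCompact_subset_measure_sdiff_le {N : ℕ} {ρ : Measure (UN N)} [IsFiniteMeasure ρ]
    {S : Set (UN N)} (hS : NullMeasurableSet S ρ) {δ : ℝ≥0∞} (hδ : δ ≠ 0) :
    ∃ K ⊆ S, IsCompact K ∧ ρ (S \ K) ≤ δ := by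
  obtain ⟨t, htS, ht, hae⟩ := hS.exists_measurable_subset_ae_eq
  obtain ⟨K, hKt, hK, hlt⟩ := ht.exists_isCompact_sdiff_lt (measure_ne_top ρ t) hδ
  refine ⟨K, hKt.trans htS, hK, le_of_eq_of_le (measure_congr ?_) hlt.le⟩
  exact hae.symm.diff (ae_eq_refl K)

/-- `F` is a limit of trace polynomials for the `L²(ρ)`-norm. -/
def IsTracePolyLimit {N : ℕ} (ρ : Measure (UN N)) (F : UN N → Mat N) : Prop :=
  ∀ ε : ℝ≥0∞, ε ≠ 0 → ∃ P : TracePoly,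
    eLpNorm (fun U => hsNorm (F U - tracePolyU N P U)) 2 ρ ≤ ε

/-! ### Closure properties of limits of trace polynomials -/

section

variable {N : ℕ} {ρ : Measure (UN N)}

theorem aestronglyMeasurable_tracePolyU (P : TracePoly) :
    AEStronglyMeasurable (tracePolyU N P) ρ :=
  (continuous_tracePolyU P).aestronglyMeasurable

theorem aestronglyMeasurable_hsNorm_sub {F G : UN N → Mat N} (hF : AEStronglyMeasurable F ρ)
    (hG : AEStronglyMeasurable G ρ) : AEStronglyMeasurable (fun U => hsNorm (F U - G U)) ρ :=
  continuous_hsNorm.comp_aestronglyMeasurable (hF.sub hG)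

theorem eLpNorm_le_ofReal [IsProbabilityMeasure ρ] {f : UN N → ℝ} {C : ℝ} (h0 : ∀ U, 0 ≤ f U)
    (h : ∀ U, f U ≤ C) : eLpNorm f 2 ρ ≤ ENNReal.ofReal C := by
  refine (eLpNorm_le_of_ae_bound (C := C) (Eventually.of_forall fun U => ?_)).trans (by simp)
  rw [Real.norm_of_nonneg (h0 U)]
  exact h U

theorem exists_ofReal_le {ε : ℝ≥0∞} (hε : ε ≠ 0) : ∃ δ : ℝ, 0 < δ ∧ ENNReal.ofReal δ ≤ ε := by
  obtain ⟨δ, h0, h⟩ := ENNReal.lt_iff_exists_nnreal_btwn.mp (pos_iff_ne_zero.mpr hε)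
  exact ⟨δ, by exact_mod_cast h0, by simpa using h.le⟩

theorem IsTracePolyLimit.zero : IsTracePolyLimit ρ fun _ : UN N => 0 := fun ε _ =>
  ⟨0, by simp [tracePolyU_zero, hsNorm_zero]⟩

theorem IsTracePolyLimit.add {F G : UN N → Mat N} (hF : IsTracePolyLimit ρ F)
    (hG : IsTracePolyLimit ρ G) (mF : AEStronglyMeasurable F ρ) (mG : AEStronglyMeasurable G ρ) :
    IsTracePolyLimit ρ fun U => F U + G U := by
  intro ε hε
  obtain ⟨P, hP⟩ := hF (ε / 2) (ENNReal.half_pos hε).ne'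
  obtain ⟨Q, hQ⟩ := hG (ε / 2) (ENNReal.half_pos hε).ne'
  refine ⟨P + Q, ?_⟩
  calc _ ≤ eLpNorm ((fun U => hsNorm (F U - tracePolyU N P U)) +
        fun U => hsNorm (G U - tracePolyU N Q U)) 2 ρ := eLpNorm_mono_real fun U => by
          rw [Real.norm_of_nonneg (hsNorm_nonneg _), tracePolyU_add, add_sub_add_comm]
          exact hsNorm_add_le _ _
    _ ≤ ε / 2 + ε / 2 := (eLpNorm_add_le
        (aestronglyMeasurable_hsNorm_sub mF (aestronglyMeasurable_tracePolyU P))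
        (aestronglyMeasurable_hsNorm_sub mG (aestronglyMeasurable_tracePolyU Q))
        (by norm_num)).trans (add_le_add hP hQ)
    _ = ε := ENNReal.add_halves ε

/-- Measurability is carried through the induction because `IsTracePolyLimit.add` needs it for the
partial sums. -/
theorem IsTracePolyLimit.sum {F : ℕ → UN N → Mat N} (hF : ∀ i, IsTracePolyLimit ρ (F i))
    (mF : ∀ i, AEStronglyMeasurable (F i) ρ) (n : ℕ) :
    IsTracePolyLimit ρ (fun U => ∑ i ∈ Finset.range n, F i U) ∧
      AEStronglyMeasurable (fun U => ∑ i ∈ Finset.range n, F i U) ρ := by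
  induction n with
  | zero =>
    simp only [Finset.range_zero, Finset.sum_empty]
    exact ⟨IsTracePolyLimit.zero, aestronglyMeasurable_const⟩
  | succ n ih =>
    simp only [Finset.sum_range_succ]
    exact ⟨ih.1.add (hF n) ih.2 (mF n), ih.2.add (mF n)⟩

/-- Limits of trace polynomials are closed under limits. -/
theorem IsTracePolyLimit.of_forall_near {F : UN N → Mat N} (mF : AEStronglyMeasurable F ρ)
    (h : ∀ ε : ℝ≥0∞, ε ≠ 0 → ∃ G : UN N → Mat N, IsTracePolyLimit ρ G ∧
      AEStronglyMeasurable G ρ ∧ eLpNorm (fun U => hsNorm (F U - G U)) 2 ρ ≤ ε) :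
    IsTracePolyLimit ρ F := by
  intro ε hε
  obtain ⟨G, hG, mG, hFG⟩ := h (ε / 2) (ENNReal.half_pos hε).ne'
  obtain ⟨P, hP⟩ := hG (ε / 2) (ENNReal.half_pos hε).ne'
  refine ⟨P, ?_⟩
  calc _ ≤ eLpNorm ((fun U => hsNorm (F U - G U)) +
        fun U => hsNorm (G U - tracePolyU N P U)) 2 ρ := eLpNorm_mono_real fun U => by
          rw [Real.norm_of_nonneg (hsNorm_nonneg _)]
          exact hsNorm_sub_le _ _ _
    _ ≤ ε / 2 + ε / 2 := (eLpNorm_add_le (aestronglyMeasurable_hsNorm_sub mF mG)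
        (aestronglyMeasurable_hsNorm_sub mG (aestronglyMeasurable_tracePolyU P))
        (by norm_num)).trans (add_le_add hFG hP)
    _ = ε := ENNReal.add_halves ε

/-- Products of trace polynomials and continuous functions of the power traces. -/
theorem isTracePolyLimit_continuous_smul [IsProbabilityMeasure ρ]
    (φ : C(range (powerTraces : UN N → {k : ℤ // k ≠ 0} → ℂ), ℂ)) (P : TracePoly) :
    IsTracePolyLimit ρ fun U => φ (rangeFactorization powerTraces U) • tracePolyU N P U := by
  intro ε hε
  obtain ⟨δ, hδ, hδε⟩ := exists_ofReal_le hε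
  obtain ⟨C, hC0, hC⟩ := exists_hsNorm_le (continuous_tracePolyU (N := N) P)
  -- `C + 1` rather than `C` keeps the denominator positive when the bound `C` is zero.
  obtain ⟨Q, hQ⟩ := exists_aeval_powerTraces_near φ (ε := δ / (C + 1)) (by positivity)
  refine ⟨LaurentPolynomial.C Q * P,
    (eLpNorm_le_ofReal (fun U => hsNorm_nonneg _) fun U => ?_).trans hδε⟩
  rw [tracePolyU_C_mul, ← sub_smul, hsNorm_smul]
  calc _ ≤ δ / (C + 1) * (C + 1) :=
        mul_le_mul (hQ U).le ((hC U).trans (by linarith)) (hsNorm_nonneg _) (by positivity)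
    _ = δ := div_mul_cancel₀ _ (by positivity)

/-- Truncations of trace polynomials to conjugation-invariant sets. -/
theorem isTracePolyLimit_indicator [IsProbabilityMeasure ρ] (hN : 0 < N) {S : Set (UN N)}
    (hS : NullMeasurableSet S ρ) (hinv : ∀ A B : UN N, B * A * B⁻¹ ∈ S ↔ A ∈ S) (P : TracePoly) :
    IsTracePolyLimit ρ (S.indicator (tracePolyU N P)) := by
  refine IsTracePolyLimit.of_forall_near ((aestronglyMeasurable_tracePolyU P).indicator₀ hS)
    fun ε hε => ?_
  obtain ⟨η, hη, hηε⟩ := exists_ofReal_le hε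
  obtain ⟨C, hC0, hC⟩ := exists_hsNorm_le (continuous_tracePolyU (N := N) P)
  -- The error will be at most `C` and supported off `K ∪ L`; `δ` is the mass of that set which can
  -- be tolerated, half for each of `S` and its complement.
  obtain ⟨δ, hδ, hδη⟩ := (memLp_const (μ := ρ) (p := 2) C).eLpNorm_indicator_le (by norm_num)
    (by norm_num) hη
  have hδ2 : ENNReal.ofReal (δ / 2) ≠ 0 := (ENNReal.ofReal_pos.mpr (half_pos hδ)).ne'
  obtain ⟨K, hKS, hK, hKδ⟩ := exists_isCompact_subset_measure_sdiff_le hS hδ2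
  obtain ⟨L, hLS, hL, hLδ⟩ := exists_isCompact_subset_measure_sdiff_le hS.compl hδ2
  have hcont : Continuous (rangeFactorization (powerTraces (N := N))) :=
    continuous_powerTraces.subtype_mk _
  -- A common image would give conjugate matrices in `K` and `L`, one in the invariant set `S` and
  -- one outside it.
  have hdisj : Disjoint (rangeFactorization (powerTraces (N := N)) '' L)
      (rangeFactorization (powerTraces (N := N)) '' K) := by
    rw [Set.disjoint_left]
    rintro _ ⟨B, hB, rfl⟩ ⟨A, hA, hAB⟩
    obtain ⟨W, rfl⟩ := exists_conj_of_powerTraces_eq hN (congrArg Subtype.val hAB)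
    exact hLS hB ((hinv A W).mpr (hKS hA))
  obtain ⟨φ, hφL, hφK, hφ⟩ := exists_continuous_zero_one_of_isClosed (hL.image hcont).isClosed
    (hK.image hcont).isClosed hdisj
  let ψ : C(range (powerTraces : UN N → {k : ℤ // k ≠ 0} → ℂ), ℂ) :=
    ⟨fun x => (φ x : ℂ), Complex.continuous_ofReal.comp φ.continuous⟩
  refine ⟨_, isTracePolyLimit_continuous_smul ψ P,
    ((ψ.continuous.comp hcont).smul (continuous_tracePolyU P)).aestronglyMeasurable, ?_⟩
  have hE : ρ (K ∪ L)ᶜ ≤ ENNReal.ofReal δ := by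
    calc ρ (K ∪ L)ᶜ ≤ ρ ((S \ K) ∪ (Sᶜ \ L)) := measure_mono fun U hU => by
          simp only [mem_compl_iff, mem_union, not_or] at hU
          by_cases h : U ∈ S
          · exact Or.inl ⟨h, hU.1⟩
          · exact Or.inr ⟨h, hU.2⟩
      _ ≤ ENNReal.ofReal (δ / 2) + ENNReal.ofReal (δ / 2) :=
          (measure_union_le _ _).trans (add_le_add hKδ hLδ)
      _ = ENNReal.ofReal δ := by
          rw [← ENNReal.ofReal_add (half_pos hδ).le (half_pos hδ).le, add_halves]
  refine le_trans (eLpNorm_mono_real fun U => ?_)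
    ((hδη _ (hK.union hL).isClosed.measurableSet.compl hE).trans hηε)
  rw [Real.norm_of_nonneg (hsNorm_nonneg _)]
  have hψ : ψ (rangeFactorization powerTraces U) = (φ (rangeFactorization powerTraces U) : ℂ) := rfl
  rw [hψ]
  by_cases hUK : U ∈ K
  · have h1 : φ (rangeFactorization powerTraces U) = 1 := hφK (mem_image_of_mem _ hUK)
    rw [indicator_of_mem (hKS hUK), h1, indicator_of_notMem (by simp [hUK])]
    simp [hsNorm_zero]
  by_cases hUL : U ∈ L
  · have h1 : φ (rangeFactorization powerTraces U) = 0 := hφL (mem_image_of_mem _ hUL)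
    rw [indicator_of_notMem (hLS hUL), h1, indicator_of_notMem (by simp [hUL])]
    simp [hsNorm_zero]
  -- Off `K ∪ L` the difference is `(1 - φ) P` or `-φ P`, and `0 ≤ φ ≤ 1` bounds its norm by that of
  -- `P`.
  rw [indicator_of_mem (s := (K ∪ L)ᶜ) (by simp [hUK, hUL])]
  obtain ⟨h0, h1⟩ := hφ (rangeFactorization powerTraces U)
  refine le_trans ?_ (hC U)
  by_cases hUS : U ∈ S
  · have h2 : ‖(1 : ℂ) - (φ (rangeFactorization powerTraces U) : ℂ)‖ ≤ 1 := by
      rw [← Complex.ofReal_one, ← Complex.ofReal_sub, Complex.norm_real, Real.norm_eq_abs, abs_le]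
      constructor <;> linarith
    rw [indicator_of_mem hUS]
    nth_rewrite 1 [← one_smul ℂ (tracePolyU N P U)]
    rw [← sub_smul, hsNorm_smul]
    exact mul_le_of_le_one_left (hsNorm_nonneg _) h2
  · have h2 : ‖-(φ (rangeFactorization powerTraces U) : ℂ)‖ ≤ 1 := by
      rw [norm_neg, Complex.norm_real, Real.norm_of_nonneg h0]
      exact h1
    rw [indicator_of_notMem hUS, zero_sub, ← neg_smul, hsNorm_smul]
    exact mul_le_of_le_one_left (hsNorm_nonneg _) h2

/-! ### Piecewise polynomial approximation of equivariant functions -/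

/-- The polynomial `∑ c_k u^k` as a trace polynomial. -/
noncomputable def polyTracePoly (c : Fin N → ℂ) : TracePoly :=
  ∑ k : Fin N, AddMonoidAlgebra.single ((k : ℕ) : ℤ) (MvPolynomial.C (c k))

theorem tracePolyU_polyTracePoly (c : Fin N → ℂ) (U : UN N) :
    tracePolyU N (polyTracePoly c) U = ∑ k, c k • (U : Mat N) ^ (k : ℕ) := by
  rw [polyTracePoly, tracePolyU_sum]
  refine Finset.sum_congr rfl fun k _ => ?_
  rw [tracePolyU_single, MvPolynomial.aeval_C, zpow_natCast]
  rfl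

/-- Countably many polynomials approximate each value of an equivariant function. -/
theorem IsEquivariant.exists_hsNorm_sub_lt (hN : 0 < N) {F : UN N → Mat N} (hF : IsEquivariant F)
    {η : ℝ} (hη : 0 < η) (U : UN N) :
    ∃ i : ℕ, hsNorm (F U -
      tracePolyU N (polyTracePoly (TopologicalSpace.denseSeq (Fin N → ℂ) i)) U) < η := by
  obtain ⟨c, hc⟩ := hF.exists_eq_sum_pow hN U
  have hcont : Continuous fun b : Fin N → ℂ => hsNorm (F U - ∑ k, b k • (U : Mat N) ^ (k : ℕ)) :=
    continuous_hsNorm.comp (by fun_prop)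
  -- The coefficient vectors with error below `η` form an open set containing the exact vector `c`.
  obtain ⟨i, hi⟩ := (TopologicalSpace.denseRange_denseSeq (Fin N → ℂ)).exists_mem_open
    (isOpen_lt hcont (continuous_const (y := η))) ⟨c, by simpa [← hc, hsNorm_zero] using hη⟩
  exact ⟨i, by rw [tracePolyU_polyTracePoly]; exact hi⟩

/-- Square-integrable equivariant functions are limits of trace polynomials, for every probability
measure on the unitary group. -/
theorem IsEquivariant.isTracePolyLimit [IsProbabilityMeasure ρ] (hN : 0 < N) {F : UN N → Mat N}
    (hF : IsEquivariant F) (mF : AEStronglyMeasurable F ρ)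
    (hL : MemLp (fun U => hsNorm (F U)) 2 ρ) : IsTracePolyLimit ρ F := by
  classical
  refine IsTracePolyLimit.of_forall_near mF fun ε hε => ?_
  obtain ⟨η, hη, hηε⟩ := exists_ofReal_le (ENNReal.half_pos hε).ne'
  let P : ℕ → TracePoly := fun i => polyTracePoly (TopologicalSpace.denseSeq (Fin N → ℂ) i)
  have hex : ∀ U, ∃ i, hsNorm (F U - tracePolyU N (P i) U) < η := fun U =>
    hF.exists_hsNorm_sub_lt hN hη U
  -- Taking the least index makes the choice canonical, hence both conjugation-invariant and
  -- null-measurable.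
  let idx : UN N → ℕ := fun U => Nat.find (hex U)
  have hidx : ∀ U, hsNorm (F U - tracePolyU N (P (idx U)) U) < η := fun U => Nat.find_spec (hex U)
  have hidx_inv : ∀ A B : UN N, idx (B * A * B⁻¹) = idx A := fun A B => by
    refine Nat.find_congr' fun {i} => ?_
    rw [hF A B, isEquivariant_tracePolyU (P i) A B, ← sub_mul, ← mul_sub, hsNorm_conj]
  have mT : ∀ i, NullMeasurableSet {U | hsNorm (F U - tracePolyU N (P i) U) < η} ρ := fun i =>
    nullMeasurableSet_lt (aestronglyMeasurable_hsNorm_sub mF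
      (aestronglyMeasurable_tracePolyU (P i))).aemeasurable aemeasurable_const
  -- `n ≤ idx U` means that none of the first `n` polynomials is `η`-close at `U`.
  have mlt : ∀ n, NullMeasurableSet {U | n ≤ idx U} ρ := fun n => by
    have : {U | n ≤ idx U} =
        ⋂ i : Fin n, {U | hsNorm (F U - tracePolyU N (P i) U) < η}ᶜ := by
      ext U
      simp only [mem_iInter, Fin.forall_iff]
      exact Nat.le_find_iff (hex U) n
    rw [this]
    exact NullMeasurableSet.iInter fun i => (mT i).compl
  have meq : ∀ n, NullMeasurableSet {U | idx U = n} ρ := fun n => by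
    have : {U | idx U = n} = {U | n ≤ idx U} \ {U | n + 1 ≤ idx U} := by
      ext U
      change idx U = n ↔ n ≤ idx U ∧ ¬ n + 1 ≤ idx U
      omega
    rw [this]
    exact (mlt n).diff (mlt (n + 1))
  have hparts := IsTracePolyLimit.sum (ρ := ρ)
    (F := fun i => {U | idx U = i}.indicator (tracePolyU N (P i)))
    (fun i => isTracePolyLimit_indicator hN (meq i)
      (fun A B => by
        change idx (B * A * B⁻¹) = i ↔ idx A = i
        rw [hidx_inv]) (P i))
    (fun i => (aestronglyMeasurable_tracePolyU (P i)).indicator₀ (meq i))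
  obtain ⟨δ, hδ, hδη⟩ := hL.eLpNorm_indicator_le (by norm_num) (by norm_num) hη
  -- Every `idx U` is finite, so these sets decrease to the empty set.
  have hlim : Tendsto (fun n => ρ {U | n ≤ idx U}) atTop (𝓝 0) := by
    have h := tendsto_measure_iInter_atTop mlt
      (fun m n hmn U (hU : n ≤ idx U) => hmn.trans hU) ⟨0, measure_ne_top ρ _⟩
    have he : ⋂ n, {U | n ≤ idx U} = ∅ := by
      refine eq_empty_of_forall_notMem fun U hU => ?_
      have : idx U + 1 ≤ idx U := mem_iInter.mp hU (idx U + 1)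
      omega
    rwa [he, measure_empty] at h
  obtain ⟨n, hn⟩ := ((tendsto_order.mp hlim).2 _ (ENNReal.ofReal_pos.mpr hδ)).exists
  refine ⟨_, (hparts n).1, (hparts n).2, ?_⟩
  -- The tail set is only null-measurable, whereas `hδη` is stated for measurable sets; its
  -- measurable hull has the same mass.
  let R := toMeasurable ρ {U | n ≤ idx U}
  -- Where `idx U < n` exactly one summand is active and the error is below `η`; elsewhere the sum
  -- vanishes and the error is the norm of `F U`.
  calc _ ≤ eLpNorm ((fun _ => η) + R.indicator fun U => hsNorm (F U)) 2 ρ :=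
        eLpNorm_mono_real fun U => by
          rw [Real.norm_of_nonneg (hsNorm_nonneg _)]
          have hsum : ∑ i ∈ Finset.range n, {U | idx U = i}.indicator (tracePolyU N (P i)) U =
              if idx U < n then tracePolyU N (P (idx U)) U else 0 := by
            simp only [indicator_apply, mem_ofPred_eq, Finset.sum_ite_eq, Finset.mem_range]
          simp only [hsum, Pi.add_apply]
          split_ifs with h
          · have : 0 ≤ R.indicator (fun U => hsNorm (F U)) U :=
              indicator_nonneg (fun _ _ => hsNorm_nonneg _) U
            linarith [hidx U]
          · have hU : U ∈ R := subset_toMeasurable ρ {U | n ≤ idx U} (not_lt.mp h)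
            rw [sub_zero, indicator_of_mem hU]
            linarith
    _ ≤ ε / 2 + ε / 2 := by
        refine (eLpNorm_add_le aestronglyMeasurable_const
          (hL.1.indicator (measurableSet_toMeasurable _ _)) (by norm_num)).trans (add_le_add ?_ ?_)
        · exact (eLpNorm_le_ofReal (fun _ => hη.le) fun _ => le_rfl).trans hηε
        · exact (hδη _ (measurableSet_toMeasurable _ _)
            ((measure_toMeasurable _).trans_le hn.le)).trans hηε
    _ = ε := ENNReal.add_halves ε

end

/-! ### The density theorem for the heat kernel measure -/

theorem tracePolyU_mem_equivariantL2 (N : ℕ) (s : ℝ) (hs : 0 < s) (P : TracePoly) :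
    tracePolyU N P ∈ equivariantL2 N s hs := by
  have := (isHeatKernelMeasure_heatKernelMeasure N s hs).isProbabilityMeasure
  obtain ⟨C, -, hC⟩ := exists_hsNorm_le (continuous_tracePolyU (N := N) P)
  refine ⟨aestronglyMeasurable_tracePolyU P, MemLp.of_bound
    (continuous_hsNorm.comp_aestronglyMeasurable (aestronglyMeasurable_tracePolyU P)) C
    (Eventually.of_forall fun U => ?_), isEquivariant_tracePolyU P⟩
  rw [Real.norm_of_nonneg (hsNorm_nonneg _)]
  exact hC U

end UnitaryHeat

theorem theorem2p6 (N : ℕ) (hN : 0 < N) (s : ℝ) (hs : 0 < s) :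
    (∀ P : UnitaryHeat.TracePoly,
      UnitaryHeat.tracePolyU N P ∈ UnitaryHeat.equivariantL2 N s hs) ∧
    ∀ F ∈ UnitaryHeat.equivariantL2 N s hs, ∀ ε : ℝ≥0∞, 0 < ε →
      ∃ P : UnitaryHeat.TracePoly,
        UnitaryHeat.l2Norm N s hs (fun U => F U - UnitaryHeat.tracePolyU N P U) < ε := by
  refine ⟨UnitaryHeat.tracePolyU_mem_equivariantL2 N s hs, ?_⟩
  rintro F ⟨mF, hL, hF⟩ ε hε
  have := (UnitaryHeat.isHeatKernelMeasure_heatKernelMeasure N s hs).isProbabilityMeasure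
  -- `IsTracePolyLimit` yields a non-strict bound; an intermediate `ε'` makes it strict.
  obtain ⟨ε', h0, hε'⟩ := exists_between hε
  obtain ⟨P, hP⟩ := hF.isTracePolyLimit hN mF hL ε' h0.ne'
  exact ⟨P, hP.trans_lt hε'⟩
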